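/- **Theorem (Uncomputability of the moment invariant ideal).** A *guarded probabilistic loop with affine updates* over variables $x=(x_1,\dots,x_k)$ consists of two locations $q_0,q_1$ and a finite set $E$ of transitions $(q,g,f,pr,q')$, where $g$ is a guard (a Boolean combination of equalities and inequalities between variables and rational constants), $f:\mathbb{Q}^k\to\mathbb{Q}^k$ is an affine map with rational coefficients and $pr\in(0,1]\cap\mathbb{Q}$. The location $q_0$ has exactly one outgoing transition, which leads to $q_1$, and every outgoing transition of $q_1$ is a self-loop. In every configuration $(q,x)$ with $x\in\mathbb{Q}^k$ at least one outgoing transition of $q$ is enabled (its guard holds at $x$), and the probabilities of the enabled transitions sum up to $1$. An execution starts in $(q_0,\vec 0)$; an enabled transition $(q,g,f,pr,q')$ leads from $(q,x)$ to $(q',f(x))$ with probability $pr$. For a monomial $M$ in $x_1,\dots,x_k$ let $\mathbb{E}[M_n]$ be the expected value of $M$ after $n$ executed transitions. For a positive integer $\ell$ let $M^{(1)},\dots,M^{(m)}$ be the monomials $x_1^{\alpha_1}\cdots x_k^{\alpha_k}$ with $\alpha_1+\dots+\alpha_k\le\ell$, and take $\mathbb{E}[M^{(1)}],\dots,\mathbb{E}[M^{(m)}]$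 as formal variables. The *moment invariant ideal of order $\ell$* of the loop is $$\mathbb{I}^{\le\ell}=\bigl\{\,p\in\overline{\mathbb{Q}}\bigl[\mathbb{E}[M^{(1)}],\dots,\mathbb{E}[M^{(m)}]\bigr] \;\bigm|\; p\bigl(\mathbb{E}[M^{(1)}_n],\dots,\mathbb{E}[M^{(m)}_n]\bigr)=0\ \text{ for all } n\ge 0\,\bigr\}.$$ Then for every $\ell\ge 1$ there is no algorithm that, given (a finite description of) a guarded probabilistic loop with affine updates, outputs a basis of its moment invariant ideal $\mathbb{I}^{\le\ell}$, that is, a finite list of polynomials generating $\mathbb{I}^{\le\ell}$, with algebraic coefficients given exactly (each as the only root of a nonzero integer polynomial in an open disc with rational centre and rational radius). -/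

import Mathlib

/-! ### Guarded probabilistic programs with affine updates -/

namespace MomentInv

/-- The affine function `x ↦ A x + b` on `ℚ^k`. -/
structure AffineUpdate (k : ℕ) where
  A : Matrix (Fin k) (Fin k) ℚ
  b : Fin k → ℚ

def AffineUpdate.apply {k : ℕ} (f : AffineUpdate k) (x : Fin k → ℚ) : Fin k → ℚ :=
  f.A.mulVec x + f.b

/-- One side of a comparison in a guard: a program variable or a rational constant. -/
inductive Operand (k : ℕ) where
  | var (i : Fin k)
  | const (c : ℚ)

def Operand.eval {k : ℕ} (x : Fin k → ℚ) : Operand k → ℚ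
  | .var i => x i
  | .const c => c

inductive Cmp where
  | eq
  | ne
  | lt
  | le

def Cmp.eval : Cmp → ℚ → ℚ → Bool
  | .eq, u, v => decide (u = v)
  | .ne, u, v => decide (u ≠ v)
  | .lt, u, v => decide (u < v)
  | .le, u, v => decide (u ≤ v)

/-- An equality or inequality between variables and constants. -/
structure Atom (k : ℕ) where
  lhs : Operand k
  cmp : Cmp
  rhs : Operand k

def Atom.eval {k : ℕ} (a : Atom k) (x : Fin k → ℚ) : Bool :=
  a.cmp.eval (a.lhs.eval x) (a.rhs.eval x)

/-- A Boolean combination of comparisons, in disjunctive normal form: the disjunction of the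
conjunctions of the inner lists. The guard `⊤` is `[[]]`. -/
abbrev Guard (k : ℕ) := List (List (Atom k))

def Guard.eval {k : ℕ} (g : Guard k) (x : Fin k → ℚ) : Bool :=
  g.any fun c => c.all fun a => a.eval x

/-- A guarded transition `(src, guard, update, prob, tgt)` over the locations `Q`. -/
structure Transition (Q : Type) (k : ℕ) where
  src : Q
  guard : Guard k
  update : AffineUpdate k
  prob : ℚ
  tgt : Q

/-- A configuration: a location and a valuation of the variables. -/
abbrev Config (Q : Type) (k : ℕ) := Q × (Fin k → ℚ)

/-- A finitely presented guarded probabilistic affine program over `k` variables. The list `E`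
enumerates the set of transitions. -/
structure Program (Q : Type) (k : ℕ) where
  q₀ : Q
  E : List (Transition Q k)

namespace Program

variable {Q : Type} [DecidableEq Q] {k : ℕ}

/-- The transitions that leave the location of `c` and whose guard holds in `c`. -/
def enabled (P : Program Q k) (c : Config Q k) : List (Transition Q k) :=
  P.E.filter fun e => decide (e.src = c.1) && e.guard.eval c.2

/-- `E` is repetition-free, probabilities lie in `(0,1]`, and in every configuration some
transition is enabled and the probabilities of the enabled transitions sum up to `1`. -/
structure Valid (P : Program Q k) : Prop where
  nodup : P.E.Nodup
  prob_mem : ∀ e ∈ P.E, 0 < e.prob ∧ e.prob ≤ 1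
  enabled_ne_nil : ∀ c : Config Q k, P.enabled c ≠ []
  prob_sum : ∀ c : Config Q k, ((P.enabled c).map fun e => e.prob).sum = 1

/-- One execution step on (finitely supported) distributions of configurations: the mass `w` of a
configuration `(q, y)` is split among its enabled transitions, `prob * w` being moved along `f`
to `(q', f y)`. -/
noncomputable def step (P : Program Q k) (μ : Config Q k →₀ ℚ) : Config Q k →₀ ℚ :=
  μ.sum fun c w => ((P.enabled c).map fun e =>
    Finsupp.single ((e.tgt, e.update.apply c.2) : Config Q k) (e.prob * w)).sum

/-- `P.dist n (q, x)` is the probability of being in location `q` with valuation `x` after `n`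
executed transitions, starting in `(q₀, 0)`. -/
noncomputable def dist (P : Program Q k) : ℕ → Config Q k →₀ ℚ
  | 0 => Finsupp.single (P.q₀, 0) 1
  | n + 1 => P.step (P.dist n)

/-- The expected value of the monomial `∏ xᵢ ^ αᵢ` after `n` executed transitions. -/
noncomputable def moment (P : Program Q k) (n : ℕ) (α : Fin k → ℕ) : ℚ :=
  (P.dist n).sum fun c w => (∏ i, c.2 i ^ α i) * w

end Program

/-- The two locations of a loop. -/
inductive Loc where
  | q0
  | q1
  deriving DecidableEq

/-- A loop: the initial location `q0` has exactly one outgoing transition, which leads to `q1`,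
and all outgoing transitions of `q1` are self-loops. -/
structure Program.IsLoop {k : ℕ} (P : Program Loc k) : Prop where
  init : P.q₀ = Loc.q0
  entry : ∃ e, P.E.filter (fun e => decide (e.src = Loc.q0)) = [e] ∧ e.tgt = Loc.q1
  self : ∀ e ∈ P.E, e.src = Loc.q1 → e.tgt = Loc.q1

/-! ### The moment invariant ideal -/

/-- The field of algebraic numbers. -/
noncomputable abbrev QBar := algebraicClosure ℚ ℂ

/-- The (exponent vectors of the) moments of order at most `ℓ`, used as formal variables. -/
abbrev Moment (k ℓ : ℕ) := {α : Fin k → ℕ // ∑ i, α i ≤ ℓ}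

/-- The polynomials in the moments of order at most `ℓ` that vanish after any number of executed
transitions. -/
noncomputable def momentIdeal {Q : Type} [DecidableEq Q] {k : ℕ} (P : Program Q k) (ℓ : ℕ) :
    Ideal (MvPolynomial (Moment k ℓ) QBar) where
  carrier := {p | ∀ n : ℕ,
    MvPolynomial.eval (fun α : Moment k ℓ => algebraMap ℚ QBar (P.moment n α.1)) p = 0}
  add_mem' hp hq n := by rw [map_add, hp n, hq n, add_zero]
  zero_mem' n := map_zero _
  smul_mem' c p hp n := by rw [smul_eq_mul, map_mul, hp n, mul_zero]

/-! ### Input of the algorithm: loops as finite data -/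

abbrev RatCode := ℤ × ℕ

/-- A rational number as numerator and denominator. -/
def ratCode (q : ℚ) : RatCode := (q.num, q.den)

abbrev UpdateCode := List (List RatCode) × List RatCode

def AffineUpdate.code {k : ℕ} (f : AffineUpdate k) : UpdateCode :=
  (List.ofFn fun i => List.ofFn fun j => ratCode (f.A i j), List.ofFn fun i => ratCode (f.b i))

abbrev OperandCode := ℕ ⊕ RatCode

def Operand.code {k : ℕ} : Operand k → OperandCode
  | .var i => Sum.inl i
  | .const c => Sum.inr (ratCode c)

def Cmp.code : Cmp → ℕ
  | .eq => 0
  | .ne => 1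
  | .lt => 2
  | .le => 3

abbrev AtomCode := OperandCode × ℕ × OperandCode

def Atom.code {k : ℕ} (a : Atom k) : AtomCode := (a.lhs.code, a.cmp.code, a.rhs.code)

abbrev GuardCode := List (List AtomCode)

def Guard.code {k : ℕ} (g : Guard k) : GuardCode := g.map fun c => c.map Atom.code

def Loc.code : Loc → Bool
  | .q0 => false
  | .q1 => true

abbrev TransitionCode := Bool × GuardCode × UpdateCode × RatCode × Bool

def Transition.code {k : ℕ} (e : Transition Loc k) : TransitionCode :=
  (e.src.code, Guard.code e.guard, e.update.code, ratCode e.prob, e.tgt.code)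

/-- The number of variables, the initial location and the list of transitions. -/
abbrev ProgramCode := ℕ × Bool × List TransitionCode

def Program.code {k : ℕ} (P : Program Loc k) : ProgramCode :=
  (k, P.q₀.code, P.E.map Transition.code)

/-! ### Output of the algorithm: finite lists of polynomials with algebraic coefficients -/

/-- A finite description of an algebraic number: an integer polynomial, by its coefficients from
degree `0` on, and an open disc with rational centre `re + im * I` and rational radius. -/
structure AlgName where
  coeffs : List ℤ
  re : ℚ
  im : ℚ
  radius : ℚ

noncomputable def AlgName.poly (a : AlgName) : Polynomial ℤ :=
  ∑ i ∈ Finset.range a.coeffs.length, Polynomial.monomial i (a.coeffs.getD i 0)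

noncomputable def AlgName.disc (a : AlgName) : Set ℂ :=
  Metric.ball (⟨(a.re : ℝ), (a.im : ℝ)⟩ : ℂ) (a.radius : ℝ)

/-- `a` denotes `z` if the polynomial of `a` is nonzero and `z` is its only root in the disc. -/
structure AlgName.Denotes (a : AlgName) (z : QBar) : Prop where
  poly_ne_zero : a.poly ≠ 0
  isRoot : Polynomial.aeval (z : ℂ) a.poly = 0
  mem_disc : (z : ℂ) ∈ a.disc
  unique : ∀ w ∈ a.disc, Polynomial.aeval w a.poly = 0 → w = z

abbrev AlgCode := List ℤ × RatCode × RatCode × RatCode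

def AlgName.code (a : AlgName) : AlgCode :=
  (a.coeffs, ratCode a.re, ratCode a.im, ratCode a.radius)

/-- A polynomial in the moments of order at most `ℓ`, written as a sum of terms: each term is a
coefficient together with the list of the moments that are multiplied (with repetitions). -/
abbrev PolyName (k ℓ : ℕ) := List (AlgName × List (Moment k ℓ))

/-- The term `t` is the polynomial `p`. -/
def TermDenotes {k ℓ : ℕ} (t : AlgName × List (Moment k ℓ))
    (p : MvPolynomial (Moment k ℓ) QBar) : Prop :=
  ∃ z : QBar, t.1.Denotes z ∧ p = MvPolynomial.C z * (t.2.map MvPolynomial.X).prod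

/-- The sum of terms `s` is the polynomial `p`. -/
def PolyDenotes {k ℓ : ℕ} (s : PolyName k ℓ) (p : MvPolynomial (Moment k ℓ) QBar) : Prop :=
  ∃ ps : List (MvPolynomial (Moment k ℓ) QBar), List.Forall₂ TermDenotes s ps ∧ p = ps.sum

/-- The finite list `B` describes polynomials that form a basis of (that is, generate) `I`. -/
def IsBasis {k ℓ : ℕ} (B : List (PolyName k ℓ)) (I : Ideal (MvPolynomial (Moment k ℓ) QBar)) :
    Prop :=
  ∃ ps : List (MvPolynomial (Moment k ℓ) QBar),
    List.Forall₂ PolyDenotes B ps ∧ Ideal.span {p | p ∈ ps} = I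

/-- A moment is given by the list of its `k` exponents. -/
abbrev PolyCode := List (AlgCode × List (List ℕ))

def polyCode {k ℓ : ℕ} (s : PolyName k ℓ) : PolyCode :=
  s.map fun t => (t.1.code, t.2.map fun α => List.ofFn α.1)

abbrev BasisCode := List PolyCode

def basisCode {k ℓ : ℕ} (B : List (PolyName k ℓ)) : BasisCode := B.map polyCode

end MomentInv

namespace MomentInv
open Turing

/-! ### Partial recursive functions on one-tape machines with unary input -/

section TuringMachine

open PartrecToTM2

/-! An algorithm for bases would make non-halting semi-decidable. A program `c` is turned into a
deterministic loop in five variables (all probabilities are `1`) that simulates a machine running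
`c` on input `0`. A flag variable stays `0` during the simulation, and halting sets every variable
to `1`. If `c` halts, all moments are `1` at some time, so every element of the ideal vanishes at
the point `(1, …, 1)`. If `c` diverges, the first moment of the flag lies in the ideal but has value
`1` at this point, so some generator does not vanish there. Thus `c` diverges exactly if some
generator has a nonzero sum of coefficients (`DecisionTree.exists_eval_one_ne_zero_iff`).

The simulation (`exists_tree_orbit`) stores each half tape as a number in `[0, 1)` whose digits are
the symbols. Pushing or popping a known symbol is affine, and comparison with constants reads off
the first digit. One machine, hence one loop body, serves all programs: the code of `c` is its input
and enters only through the initial update.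

It remains to semi-decide that a sum of exactly given algebraic numbers is nonzero
(`rePred_exists_certifies`, `exists_certifies_iff`). A certificate lists Gaussian rationals near the
coefficients whose sum exceeds the total error. That they are near is checked by integer arithmetic:
an integer polynomial that is tiny at a point has a root close by (`exists_root_near`), and the
isolating disc identifies this root. -/

theorem trNat_two_pow_sub_one (n : ℕ) :
    trNat (2 ^ n - 1) = List.replicate n PartrecToTM2.Γ'.bit1 := by
  induction n with
  | zero => simp
  | succ n ih =>
    have h : 2 ^ (n + 1) - 1 = Nat.bit true (2 ^ n - 1) := by
      have := Nat.one_le_two_pow (n := n)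
      simp only [Nat.bit, cond_true]
      omega
    rw [h, trNat]
    rw [trNat] at ih
    rw [List.replicate_succ, ← ih]
    have h2 : ((Nat.bit true (2 ^ n - 1) : ℕ) : Num) = Num.bit1 ((2 ^ n - 1 : ℕ) : Num) := by
      rw [← Num.ofNat'_eq, Num.ofNat'_bit, Num.ofNat'_eq]; rfl
    rw [h2]
    cases ((2 ^ n - 1 : ℕ) : Num) <;> rfl

instance : Finite K' :=
  Finite.of_injective (β := Fin 4)
    (fun k => match k with | .main => 0 | .rev => 1 | .aux => 2 | .stack => 3)
    (by intro a b; cases a <;> cases b <;> simp)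

/-- The binary numeral of `2 ^ n - 1` consists of `n` ones. Compiling a function that first recovers
`n` from this number therefore gives a machine whose initial tape depends on `n` only through the
number of repetitions of one symbol, which a loop can write with a counter. -/
theorem exists_TM0 {f : ℕ →. ℕ} (hf : Partrec f) :
    ∃ (Γ Λ : Type) (_ : Inhabited Γ) (_ : Finite Γ) (_ : Inhabited Λ) (M : TM0.Machine Γ Λ)
      (S : Finset Λ) (a b : Γ), TM0.Supports M (S : Set Λ) ∧
      ∀ n, (TM0.eval M (a :: List.replicate n b)).Dom ↔ (f n).Dom := by
  -- The search recovers `n` from `x = 2 ^ n - 1`; it diverges at all other `x`, which are never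
  -- used.
  have hg : Partrec (fun x : ℕ =>
      (Nat.rfind fun n => Part.some (decide (2 ^ n = x + 1))).bind f) := by
    refine Partrec.bind (Partrec.rfind ?_) (hf.comp Computable.snd).to₂
    have hpow : Primrec₂ fun a b : ℕ => a ^ b := Primrec₂.unpaired'.1 Nat.Primrec.pow
    have : PrimrecRel fun x n : ℕ => 2 ^ n = x + 1 :=
      Primrec.eq.comp (hpow.comp (Primrec.const 2) Primrec.snd) (Primrec.succ.comp Primrec.fst)
    exact Computable.partrec (Primrec.to_comp (this.decide))
  have hv : Partrec (fun v : List.Vector ℕ 1 =>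
      (Nat.rfind fun n => Part.some (decide (2 ^ n = v.head + 1))).bind f) :=
    hg.comp (Primrec.vector_head.to_comp)
  obtain ⟨c, hc⟩ := ToPartrec.Code.exists_code (Nat.Partrec'.part_iff.2 hv)
  have hdom : ∀ n, (c.eval [2 ^ n - 1]).Dom ↔ (f n).Dom := by
    intro n
    have h := hc ((2 ^ n - 1) ::ᵥ List.Vector.nil)
    have h1 : ((2 ^ n - 1) ::ᵥ List.Vector.nil : List.Vector ℕ 1).1 = [2 ^ n - 1] := rfl
    rw [h1] at h
    rw [h]
    have h2 : (Nat.rfind fun m => Part.some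
        (decide (2 ^ m = ((2 ^ n - 1) ::ᵥ List.Vector.nil : List.Vector ℕ 1).head + 1))) =
        Part.some n := by
      rw [Part.eq_some_iff]
      refine Nat.mem_rfind.2 ?_
      have := Nat.one_le_two_pow (n := n)
      have e : 2 ^ n - 1 + 1 = 2 ^ n := by omega
      simp only [List.Vector.head_cons, Part.mem_some_iff, e]
      refine ⟨by simp, fun {m} hm => ?_⟩
      have := Nat.pow_lt_pow_right (a := 2) (by norm_num) hm
      simp; omega
    rw [h2, show (Part.some n).bind f = f n from Part.bind_some _ _]
    rfl
  let : Inhabited PartrecToTM2.Λ' := ⟨trNormal c Cont'.halt⟩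
  let : Fintype K' := Fintype.ofFinite _
  let M1 := TM2to1.tr (K := K') (Γ := fun _ => PartrecToTM2.Γ') (σ := Option PartrecToTM2.Γ')
    PartrecToTM2.tr
  have hs2 : TM2.Supports PartrecToTM2.tr (codeSupp c Cont'.halt) := tr_supports c Cont'.halt
  have hs1 := TM2to1.tr_supports PartrecToTM2.tr hs2
  have hs0 := TM1to0.tr_supports M1 hs1
  let g : PartrecToTM2.Γ' → TM2to1.Γ' K' (fun _ => PartrecToTM2.Γ') :=
    fun a => (false, Function.update (fun _ => none) K'.main (some a))
  -- The first tape cell carries the bottom mark `true` of the stacks.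
  let g₀ : TM2to1.Γ' K' (fun _ => PartrecToTM2.Γ') :=
    (true, Function.update (fun _ => none) K'.main (some .cons))
  have e (n : ℕ) : TM2to1.trInit (K := K') (Γ := fun _ => PartrecToTM2.Γ') K'.main
      (trList [2 ^ n - 1]) = g₀ :: List.replicate n (g .bit1) := by
    simp only [trList, trNat_two_pow_sub_one, TM2to1.trInit, List.reverse_append,
      List.reverse_cons, List.reverse_nil, List.nil_append, List.reverse_replicate,
      List.singleton_append]
    exact congrArg (List.cons g₀) (List.map_replicate (f := g))
  refine ⟨_, _, inferInstance, Finite.of_fintype _, inferInstance, TM1to0.tr M1, _,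
    g₀, g .bit1, hs0, fun n => ?_⟩
  rw [← e, TM1to0.tr_eval, ← hdom]
  refine (TM2to1.tr_eval_dom _ _ _).trans ?_
  have e2 : (TM2.init K'.main (trList [2 ^ n - 1]) :
      TM2.Cfg (fun _ : K' => PartrecToTM2.Γ') PartrecToTM2.Λ' (Option PartrecToTM2.Γ')) =
      PartrecToTM2.init c [2 ^ n - 1] := by
    simp only [TM2.init, PartrecToTM2.init]
    congr 1
    funext k
    cases k <;> rfl
  change (StateTransition.eval (TM2.step PartrecToTM2.tr) (TM2.init K'.main _)).Dom ↔ _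
  rw [e2, tr_eval]
  rfl

end TuringMachine
end MomentInv

namespace MomentInv

/-! ### Deterministic loops from decision trees -/

section Deterministic

variable {k : ℕ}

/-- Comparisons are closed under negation because the order is linear, so the else-branch of a node
is again guarded by a conjunction of atoms. -/
def Atom.neg (a : Atom k) : Atom k :=
  match a.cmp with
  | .eq => ⟨a.lhs, .ne, a.rhs⟩
  | .ne => ⟨a.lhs, .eq, a.rhs⟩
  | .lt => ⟨a.rhs, .le, a.lhs⟩
  | .le => ⟨a.rhs, .lt, a.lhs⟩

theorem Atom.neg_ne (a : Atom k) : a.neg ≠ a := by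
  obtain ⟨l, c, r⟩ := a
  cases c <;> simp [Atom.neg]

theorem Atom.eval_neg (a : Atom k) (x : Fin k → ℚ) : a.neg.eval x = !a.eval x := by
  obtain ⟨l, c, r⟩ := a
  rw [Bool.eq_iff_iff]
  cases c <;> simp [Atom.neg, Atom.eval, Cmp.eval]

/-- A decision tree of comparisons with affine updates at its leaves. -/
inductive DecisionTree (k : ℕ) where
  | leaf (f : AffineUpdate k)
  | node (a : Atom k) (t e : DecisionTree k)

namespace DecisionTree

/-- The update that is selected at `x`, applied to `x`. -/
def eval : DecisionTree k → (Fin k → ℚ) → (Fin k → ℚ)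
  | leaf f, x => f.apply x
  | node a t e, x => if a.eval x then t.eval x else e.eval x

/-- The conjunctions of comparisons that lead to the leaves, with the updates found there. -/
def paths : DecisionTree k → List (List (Atom k) × AffineUpdate k)
  | leaf f => [([], f)]
  | node a t e =>
    (t.paths.map fun p => (a :: p.1, p.2)) ++ (e.paths.map fun p => (a.neg :: p.1, p.2))

theorem nodup_paths (t : DecisionTree k) : t.paths.Nodup := by
  induction t with
  | leaf f => simp [paths]
  | node a t e iht ihe =>
    have inj (b : Atom k) : Function.Injective
        fun p : List (Atom k) × AffineUpdate k => (b :: p.1, p.2) := by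
      rintro ⟨p, f⟩ ⟨q, g⟩ h
      simpa using h
    refine List.Nodup.append (iht.map (inj _)) (ihe.map (inj _)) ?_
    intro p hp hq
    simp only [List.mem_map] at hp hq
    obtain ⟨p', -, rfl⟩ := hp
    obtain ⟨q', -, h⟩ := hq
    simp only [Prod.mk.injEq, List.cons.injEq] at h
    exact a.neg_ne h.1.1

/-- At each node exactly one of the comparison and its negation holds, so exactly one path is open.
This is why probability `1` on every transition gives a valid program. -/
theorem exists_filter_paths (t : DecisionTree k) (x : Fin k → ℚ) :
    ∃ p, t.paths.filter (fun p => p.1.all fun a => a.eval x) = [p] ∧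
      p.2.apply x = t.eval x := by
  induction t with
  | leaf f => exact ⟨([], f), by simp [paths], rfl⟩
  | node a t e iht ihe =>
    obtain ⟨p, hp, hp'⟩ := iht
    obtain ⟨q, hq, hq'⟩ := ihe
    cases h : a.eval x
    · refine ⟨(a.neg :: q.1, q.2), ?_, by simp [eval, h, hq']⟩
      simp only [paths, List.filter_append, List.filter_map, Function.comp_def, List.all_cons, h,
        Atom.eval_neg]
      simpa using hq
    · refine ⟨(a :: p.1, p.2), ?_, by simp [eval, h, hp']⟩
      simp only [paths, List.filter_append, List.filter_map, Function.comp_def, List.all_cons, h,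
        Atom.eval_neg]
      simpa using hp

/-- In a chain of trees one of whose links decides on `x`, that link gives the value at `x`. -/
theorem eval_foldr_eq {ι : Type*} (g : ι → DecisionTree k → DecisionTree k) (d : DecisionTree k)
    {l : List ι} {i : ι}
    (hi : i ∈ l) {x y : Fin k → ℚ} (h₁ : ∀ r, (g i r).eval x = y)
    (h₂ : ∀ j ∈ l, j ≠ i → ∀ r, (g j r).eval x = r.eval x) : (l.foldr g d).eval x = y := by
  induction l with
  | nil => simp at hi
  | cons j l ih =>
    rw [List.foldr_cons]
    by_cases hj : j = i
    · rw [hj, h₁]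
    · rw [h₂ j (by simp) hj]
      exact ih (by simpa [Ne.symm hj] using hi) fun j' hj' => h₂ j' (by simp [hj'])

/-- The loop that is entered with the update `f` and then iterates the tree. -/
def loop (f : AffineUpdate k) (t : DecisionTree k) : Program Loc k where
  q₀ := .q0
  E := ⟨.q0, [[]], f, 1, .q1⟩ :: t.paths.map fun p => ⟨.q1, [p.1], p.2, 1, .q1⟩

variable (f : AffineUpdate k) (t : DecisionTree k)

theorem loop_enabled_q0 (x : Fin k → ℚ) :
    (t.loop f).enabled (.q0, x) = [⟨.q0, [[]], f, 1, .q1⟩] := by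
  simp [Program.enabled, loop, Guard.eval, List.filter_map, Function.comp_def]

theorem exists_loop_enabled_q1 (x : Fin k → ℚ) :
    ∃ e : Transition Loc k, (t.loop f).enabled (.q1, x) = [e] ∧ e.prob = 1 ∧ e.tgt = .q1 ∧
      e.update.apply x = t.eval x := by
  obtain ⟨p, hp, hp'⟩ := t.exists_filter_paths x
  refine ⟨⟨.q1, [p.1], p.2, 1, .q1⟩, ?_, rfl, rfl, hp'⟩
  simp [Program.enabled, loop, Guard.eval, List.filter_map, Function.comp_def, hp]

theorem loop_valid : (t.loop f).Valid where
  nodup := by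
    refine List.nodup_cons.2 ⟨by simp, t.nodup_paths.map ?_⟩
    rintro ⟨p, g⟩ ⟨q, h⟩ e
    simpa using e
  prob_mem e he := by
    have : e.prob = 1 := by
      rcases List.mem_cons.1 he with rfl | he
      · rfl
      · obtain ⟨p, -, rfl⟩ := List.mem_map.1 he
        rfl
    simp [this]
  enabled_ne_nil := by
    rintro ⟨_ | _, x⟩
    · simp [loop_enabled_q0]
    · obtain ⟨e, he, -⟩ := exists_loop_enabled_q1 f t x
      simp [he]
  prob_sum := by
    rintro ⟨_ | _, x⟩
    · simp [loop_enabled_q0]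
    · obtain ⟨e, he, h, -⟩ := exists_loop_enabled_q1 f t x
      simp [he, h]

theorem loop_isLoop : (t.loop f).IsLoop where
  init := rfl
  entry := ⟨⟨.q0, [[]], f, 1, .q1⟩, by
    simp [loop, List.filter_map, Function.comp_def], rfl⟩
  self e he h := by
    rcases List.mem_cons.1 he with rfl | he
    · simp at h
    · obtain ⟨p, -, rfl⟩ := List.mem_map.1 he
      rfl

/-- The valuations along the only execution of the loop. -/
def orbit : ℕ → Fin k → ℚ
  | 0 => 0
  | n + 1 => t.eval^[n] (f.apply 0)

theorem step_single {P : Program Loc k} {c : Config Loc k} {e : Transition Loc k}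
    (he : P.enabled c = [e]) (h : e.prob = 1) :
    P.step (Finsupp.single c 1) = Finsupp.single (e.tgt, e.update.apply c.2) 1 := by
  rw [Program.step, Finsupp.sum_single_index (by simp [he]), he]
  simp [h]

theorem loop_dist_succ (n : ℕ) :
    (t.loop f).dist (n + 1) = Finsupp.single (.q1, orbit f t (n + 1)) 1 := by
  induction n with
  | zero =>
    change (t.loop f).step (Finsupp.single (.q0, 0) 1) = _
    rw [step_single (loop_enabled_q0 f t 0) rfl]
    rfl
  | succ n ih =>
    obtain ⟨e, he, h, htgt, hu⟩ := exists_loop_enabled_q1 f t (orbit f t (n + 1))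
    rw [Program.dist, ih, step_single he h, htgt, hu]
    simp only [orbit, Function.iterate_succ_apply']

/-- The distribution is a point mass, so expectations are plain values along the orbit. -/
theorem loop_moment (n : ℕ) (α : Fin k → ℕ) :
    (t.loop f).moment n α = ∏ i, orbit f t n i ^ α i := by
  cases n with
  | zero =>
    rw [Program.moment, Program.dist, Finsupp.sum_single_index (by simp)]
    simp [orbit]
  | succ n =>
    rw [Program.moment, loop_dist_succ, Finsupp.sum_single_index (by simp)]
    simp

/-- A loop whose flag variable stays `0` unless all variables become `1` is recognised by the
values of a generating set of its moment invariant ideal at the point `1`. -/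
theorem exists_eval_one_ne_zero_iff {ℓ : ℕ} (hℓ : 1 ≤ ℓ) (i : Fin k)
    (h : (∃ n, orbit f t n = 1) ∨ ∀ n, orbit f t n i = 0)
    {s : Set (MvPolynomial (Moment k ℓ) QBar)}
    (hs : Ideal.span s = momentIdeal (t.loop f) ℓ) :
    (∃ p ∈ s, MvPolynomial.eval (fun _ => (1 : QBar)) p ≠ 0) ↔ ¬ ∃ n, orbit f t n = 1 := by
  constructor
  · rintro ⟨p, hp, hp1⟩ ⟨n, hn⟩
    have hmem : p ∈ momentIdeal (t.loop f) ℓ := hs ▸ Ideal.subset_span hp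
    apply hp1
    have := hmem n
    simpa [loop_moment, hn] using this
  · intro hn
    have h0 := h.resolve_left hn
    by_contra! hall
    -- The first moment of the flag variable; it is available because `1 ≤ ℓ`.
    let α : Moment k ℓ := ⟨Pi.single i 1, by simpa using hℓ⟩
    have hmem : MvPolynomial.X α ∈ momentIdeal (t.loop f) ℓ := by
      intro n
      rw [MvPolynomial.eval_X, loop_moment, map_eq_zero_iff _ (algebraMap ℚ QBar).injective]
      exact Finset.prod_eq_zero (Finset.mem_univ i) (by simp [α, h0])
    rw [← hs] at hmem
    have hle : Ideal.span s ≤ RingHom.ker (MvPolynomial.eval fun _ : Moment k ℓ => (1 : QBar)) :=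
      Ideal.span_le.2 hall
    have := hle hmem
    simp at this

end DecisionTree

end Deterministic

end MomentInv

namespace MomentInv
open Turing

/-! ### Half tapes as rational numbers -/

section Digits

variable {Γ : Type*} (d : Γ → ℕ) (B : ℕ)

/-- The rational number in `[0, 1)` whose digits in base `B` are given by the list. -/
def digitsVal : List Γ → ℚ
  | [] => 0
  | a :: l => (d a + digitsVal l) / B

/-- The half tape `L` is coded by the rational number `x`. -/
def Codes [Inhabited Γ] (L : ListBlank Γ) (x : ℚ) : Prop :=
  ∃ l, L = ListBlank.mk l ∧ x = digitsVal d B l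

variable {d B}

theorem digitsVal_mem (hB : ∀ a, d a < B) (l : List Γ) :
    0 ≤ digitsVal d B l ∧ digitsVal d B l < 1 := by
  induction l with
  | nil => simp [digitsVal]
  | cons a l ih =>
    have h : (d a : ℚ) + 1 ≤ B := by exact_mod_cast hB a
    have h0 : (0 : ℚ) ≤ d a := by positivity
    have hp : (0 : ℚ) < B := by linarith
    rw [digitsVal, div_lt_one hp]
    exact ⟨div_nonneg (by linarith) hp.le, by linarith⟩

variable [Inhabited Γ]

theorem Codes.cons {L : ListBlank Γ} {x : ℚ} (h : Codes d B L x) (a : Γ) :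
    Codes d B (L.cons a) ((d a + x) / B) := by
  obtain ⟨l, rfl, rfl⟩ := h
  exact ⟨a :: l, rfl, rfl⟩

/-- Popping shifts the expansion by one digit. The blank must have digit `0` so that this also works
beyond the written part of the tape, where `x = 0`. -/
theorem Codes.tail (hB : ∀ a, d a < B) (h0 : d default = 0) {L : ListBlank Γ} {x : ℚ}
    (h : Codes d B L x) : Codes d B L.tail (B * x - d L.head) := by
  obtain ⟨l, rfl, rfl⟩ := h
  cases l with
  | nil => exact ⟨[], rfl, by simp [digitsVal, h0]⟩
  | cons a l =>
    have hp : (B : ℚ) ≠ 0 := by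
      have := hB a
      norm_cast
      omega
    refine ⟨l, rfl, ?_⟩
    simp only [digitsVal, ListBlank.head_mk, List.headI_cons]
    field_simp
    ring

/-- Since `B * x - d L.head` codes the tail, it lies in `[0, 1)`; so the digit of the head is the
integer part of `B * x`. -/
theorem Codes.head_iff (hd : Function.Injective d) (hB : ∀ a, d a < B) (h0 : d default = 0)
    {L : ListBlank Γ} {x : ℚ} (h : Codes d B L x) (a : Γ) :
    (d a / B ≤ x ∧ x < (d a + 1) / B) ↔ a = L.head := by
  have hp : (0 : ℚ) < B := by exact_mod_cast (Nat.zero_le _).trans_lt (hB a)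
  obtain ⟨l, hl, hx⟩ := h.tail hB h0
  have hm := digitsVal_mem hB l
  rw [← hx] at hm
  rw [div_le_iff₀ hp, lt_div_iff₀ hp]
  constructor
  · rintro ⟨h1, h2⟩
    apply hd
    have h3 : (d a : ℚ) < d L.head + 1 := by linarith
    have h4 : (d L.head : ℚ) < d a + 1 := by linarith
    norm_cast at h3 h4
    omega
  · rintro rfl
    constructor <;> linarith

theorem exists_digits (Γ : Type*) [Inhabited Γ] [Finite Γ] :
    ∃ (d : Γ → ℕ) (B : ℕ), Function.Injective d ∧ (∀ a, d a < B) ∧ d default = 0 := by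
  classical
  obtain ⟨n, ⟨e⟩⟩ := Finite.exists_equiv_fin Γ
  -- Digit `0` is reserved for the blank; all other digits are shifted by one.
  refine ⟨fun a => if a = default then 0 else e a + 1, n + 1, fun a b h => ?_, fun a => ?_,
    by simp⟩
  · dsimp only at h
    split_ifs at h with h1 h2 h2
    · rw [h1, h2]
    · exact e.injective (Fin.ext (by omega))
  · dsimp only
    split_ifs <;> omega

end Digits

/-! ### Simulation of Turing machines -/

section Simulation

/-- The update `xᵢ ↦ aᵢ xᵢ + bᵢ`. -/
def diagonalUpdate {k : ℕ} (a b : Fin k → ℚ) : AffineUpdate k := ⟨Matrix.diagonal a, b⟩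

theorem diagonalUpdate_apply {k : ℕ} (a b x : Fin k → ℚ) :
    (diagonalUpdate a b).apply x = fun i => a i * x i + b i := by
  ext i
  simp [diagonalUpdate, AffineUpdate.apply, Matrix.mulVec_diagonal]

variable {Γ Λ : Type} [Inhabited Γ] [Inhabited Λ] (M : TM0.Machine Γ Λ) (d : Γ → ℕ) (B : ℕ)
  (γ : Λ × Γ → ℕ) (syms : List Γ)

/-- Popping a symbol from the half tape that is coded by the variable `i`, and continuing with the
update that `f` gives for this symbol. -/
def popTree (i : Fin 5) (f : Γ → AffineUpdate 5) : DecisionTree 5 :=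
  syms.foldr (fun a r => .node ⟨.const (d a / B), .le, .var i⟩
    (.node ⟨.var i, .lt, .const ((d a + 1) / B)⟩ (.leaf (f a)) r) r)
    (.leaf (diagonalUpdate 1 0))

/-- The variables are a halting flag, the code of the state and of the scanned symbol
(increased by `1`), the left half tape, the right half tape, and an input counter. -/
def stateTree (q : Λ) (a : Γ) : DecisionTree 5 :=
  match M q a with
  | none => .leaf (diagonalUpdate 0 1)
  | some (q', .write a') => .leaf (diagonalUpdate ![1, 0, 1, 1, 1] ![0, γ (q', a') + 1, 0, 0, 0])
  | some (q', .move .left) => popTree d B syms 2 fun a' =>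
      diagonalUpdate ![1, 0, B, 1 / B, 1] ![0, γ (q', a') + 1, -d a', d a / B, 0]
  | some (q', .move .right) => popTree d B syms 3 fun a' =>
      diagonalUpdate ![1, 0, 1 / B, B, 1] ![0, γ (q', a') + 1, d a / B, -d a', 0]

/-- While the state variable is `0`, copies of `b` are pushed on the right half tape, as many as the
input counter says; then the machine is started in state `q₀` on the symbol `a₀`. -/
def machineTree (states : List (Λ × Γ)) (q₀ : Λ) (a₀ b : Γ) : DecisionTree 5 :=
  .node ⟨.var 1, .eq, .const 0⟩
    (.node ⟨.var 4, .eq, .const 0⟩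
      (.leaf (diagonalUpdate 1 ![0, γ (q₀, a₀) + 1, 0, 0, 0]))
      (.leaf (diagonalUpdate ![1, 1, 1, 1 / B, 1] ![0, 0, 0, d b / B, -1])))
    (states.foldr (fun c r => .node ⟨.var 1, .eq, .const (γ c + 1)⟩
      (stateTree M d B γ syms c.1 c.2) r) (.leaf (diagonalUpdate 1 0)))

variable {M d B γ syms}

theorem popTree_eval (hd : Function.Injective d) (hB : ∀ a, d a < B)
    (h0 : d default = 0) (hsyms : ∀ a, a ∈ syms) {i : Fin 5} {f : Γ → AffineUpdate 5}
    {L : ListBlank Γ} {x : Fin 5 → ℚ} (hL : Codes d B L (x i)) :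
    (popTree d B syms i f).eval x = (f L.head).apply x := by
  refine DecisionTree.eval_foldr_eq _ _ (hsyms L.head) (fun r => ?_) fun a _ ha r => ?_
  · have := (hL.head_iff hd hB h0 L.head).2 rfl
    simp [DecisionTree.eval, Atom.eval, Cmp.eval, Operand.eval, this.1, this.2]
  · have := mt (hL.head_iff hd hB h0 a).1 ha
    by_cases h1 : (d a : ℚ) / B ≤ x i
    · have h2 : ¬ x i < (d a + 1) / B := fun h => this ⟨h1, h⟩
      simp [DecisionTree.eval, Atom.eval, Cmp.eval, Operand.eval, h2]
    · simp [DecisionTree.eval, Atom.eval, Cmp.eval, Operand.eval, h1]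

/-- The valuation `x` represents the configuration `c`. -/
def Represents (d : Γ → ℕ) (B : ℕ) (γ : Λ × Γ → ℕ) (c : TM0.Cfg Γ Λ)
    (x : Fin 5 → ℚ) : Prop :=
  x 0 = 0 ∧ x 1 = γ (c.q, c.Tape.head) + 1 ∧ Codes d B c.Tape.left (x 2) ∧
    Codes d B c.Tape.right (x 3)

variable {S : Finset Λ} {states : List (Λ × Γ)} {q₀ : Λ} {a₀ b : Γ}

/-- The shift by `1` makes the state variable positive, which rules out the input phase, and
injectivity of `γ` on the supported states selects one link of the chain. -/
theorem machineTree_eval_of_represents (hstates : ∀ c : Λ × Γ, c ∈ states ↔ c.1 ∈ S)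
    (hγ : Set.InjOn γ {c | c.1 ∈ S}) {c : TM0.Cfg Γ Λ} {x : Fin 5 → ℚ} (hc : c.q ∈ S)
    (h : Represents d B γ c x) :
    (machineTree M d B γ syms states q₀ a₀ b).eval x =
      (stateTree M d B γ syms c.q c.Tape.head).eval x := by
  have h1 : x 1 ≠ 0 := by
    rw [h.2.1]
    positivity
  rw [machineTree, DecisionTree.eval,
    if_neg (by simp [Atom.eval, Cmp.eval, Operand.eval, h1])]
  refine DecisionTree.eval_foldr_eq _ _ (i := (c.q, c.Tape.head)) ((hstates _).2 hc) (fun r => ?_)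
    fun c' hc' hne r => ?_
  · simp [DecisionTree.eval, Atom.eval, Cmp.eval, Operand.eval, h.2.1]
  · have : γ (c.q, c.Tape.head) ≠ γ c' := fun e => hne (hγ hc ((hstates _).1 hc') e).symm
    simp [DecisionTree.eval, Atom.eval, Cmp.eval, Operand.eval, h.2.1, this]

theorem stateTree_eval_of_step_eq_none {c : TM0.Cfg Γ Λ} (x : Fin 5 → ℚ)
    (h : TM0.step M c = none) : (stateTree M d B γ syms c.q c.Tape.head).eval x = 1 := by
  have : M c.q c.Tape.head = none := by simpa [TM0.step] using h
  simp only [stateTree, this, DecisionTree.eval, diagonalUpdate_apply]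
  ext i
  simp

/-- A move pops a symbol from one half tape and pushes the scanned symbol on the other. Both symbols
are constants at the selected leaf, so both operations are affine there. -/
theorem stateTree_eval_of_step_eq_some (hd : Function.Injective d) (hB : ∀ a, d a < B)
    (h0 : d default = 0) (hsyms : ∀ a, a ∈ syms) {c c' : TM0.Cfg Γ Λ} {x : Fin 5 → ℚ}
    (hx : Represents d B γ c x) (h : TM0.step M c = some c') :
    Represents d B γ c' ((stateTree M d B γ syms c.q c.Tape.head).eval x) := by
  obtain ⟨q, ⟨a, L, R⟩⟩ := c
  obtain ⟨x0, x1, xL, xR⟩ := hx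
  simp only [TM0.step, Option.map_eq_some_iff] at h
  obtain ⟨⟨q', s⟩, hs, rfl⟩ := h
  rcases s with (_ | _) | a'
  · simp only [stateTree, hs]
    rw [popTree_eval hd hB h0 hsyms xL, diagonalUpdate_apply]
    refine ⟨by simp [x0], by simp [Tape.move], ?_, ?_⟩
    · simpa [Tape.move, sub_eq_add_neg] using xL.tail hB h0
    · have := xR.cons a
      rw [add_div, add_comm, div_eq_mul_one_div (x 3), mul_comm (x 3)] at this
      simpa [Tape.move] using this
  · simp only [stateTree, hs]
    rw [popTree_eval hd hB h0 hsyms xR, diagonalUpdate_apply]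
    refine ⟨by simp [x0], by simp [Tape.move], ?_, ?_⟩
    · have := xL.cons a
      rw [add_div, add_comm, div_eq_mul_one_div (x 2), mul_comm (x 2)] at this
      simpa [Tape.move] using this
    · simpa [Tape.move, sub_eq_add_neg] using xR.tail hB h0
  · simp only [stateTree, hs, DecisionTree.eval, diagonalUpdate_apply]
    refine ⟨by simp [x0], by simp [Tape.write], ?_, ?_⟩
    · simpa [Tape.write] using xL
    · simpa [Tape.write] using xR

/-- The update that starts the simulation on the input `n`. -/
def entryUpdate (n : ℕ) : AffineUpdate 5 := ⟨0, ![0, 0, 0, 0, n]⟩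

/-- The valuation while the input is being written, when `j` symbols `b` have been written and `m`
symbols are still to be written. -/
def inputVal (d : Γ → ℕ) (B : ℕ) (b : Γ) (j m : ℕ) : Fin 5 → ℚ :=
  ![0, 0, 0, digitsVal d B (List.replicate j b), m]

omit [Inhabited Γ] in
theorem entryUpdate_apply_zero (n : ℕ) :
    (entryUpdate n).apply 0 = inputVal d B b 0 n := by
  ext i
  fin_cases i <;> simp [entryUpdate, AffineUpdate.apply, inputVal, digitsVal]

omit [Inhabited Γ] in
theorem machineTree_eval_inputVal_succ (j m : ℕ) :
    (machineTree M d B γ syms states q₀ a₀ b).eval (inputVal d B b j (m + 1)) =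
      inputVal d B b (j + 1) m := by
  have h : (m : ℚ) + 1 ≠ 0 := by positivity
  simp only [machineTree, DecisionTree.eval, Atom.eval, Cmp.eval, Operand.eval,
    diagonalUpdate_apply]
  ext i
  fin_cases i <;> simp [inputVal, h, List.replicate_succ, digitsVal]
  ring

theorem represents_machineTree_eval_inputVal_zero (j : ℕ) :
    Represents d B γ (TM0.init (a₀ :: List.replicate j b))
      ((machineTree M d B γ syms states default a₀ b).eval (inputVal d B b j 0)) := by
  simp only [machineTree, DecisionTree.eval, Atom.eval, Cmp.eval, Operand.eval,
    diagonalUpdate_apply]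
  refine ⟨by simp [inputVal], by simp [inputVal, TM0.init, Tape.mk₁, Tape.mk₂], ?_, ?_⟩
  · exact ⟨[], rfl, by simp [inputVal, digitsVal]⟩
  · exact ⟨List.replicate j b, rfl, by simp [inputVal]⟩

omit [Inhabited Γ] in
theorem iterate_machineTree_eval_inputVal (j m : ℕ) :
    (machineTree M d B γ syms states q₀ a₀ b).eval^[m] (inputVal d B b j m) =
      inputVal d B b (j + m) 0 := by
  induction m generalizing j with
  | zero => rfl
  | succ m ih =>
    rw [Function.iterate_succ_apply, machineTree_eval_inputVal_succ, ih]
    congr 1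
    omega

end Simulation

/-- Every partial recursive function has a loop with a fixed body that, entered with `n`, sets all
variables to `1` if the function is defined at `n`, and keeps the first variable `0` if not. -/
theorem exists_tree_orbit {f : ℕ →. ℕ} (hf : Partrec f) :
    ∃ t : DecisionTree 5, ∀ n, ((f n).Dom → ∃ m, DecisionTree.orbit (entryUpdate n) t m = 1) ∧
      (¬ (f n).Dom → ∀ m, DecisionTree.orbit (entryUpdate n) t m 0 = 0) := by
  classical
  obtain ⟨Γ, Λ, _, _, _, M, S, a₀, b, hS, hM⟩ := exists_TM0 hf
  obtain ⟨d, B, hd, hB, h0⟩ := exists_digits Γ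
  have : Fintype Γ := Fintype.ofFinite Γ
  -- `Λ` may be infinite; only the finitely many supported states are numbered and tested.
  obtain ⟨γ, hγ⟩ : ∃ γ : Λ × Γ → ℕ, Set.InjOn γ {c | c.1 ∈ S} := by
    refine Set.countable_iff_exists_injOn.1 (Set.Finite.countable ?_)
    refine (S ×ˢ (Finset.univ : Finset Γ)).finite_toSet.subset fun c hc => ?_
    simpa using hc
  let states := (S ×ˢ (Finset.univ : Finset Γ)).toList
  let syms := (Finset.univ : Finset Γ).toList
  have hstates : ∀ c : Λ × Γ, c ∈ states ↔ c.1 ∈ S := by simp [states]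
  have hsyms : ∀ a : Γ, a ∈ syms := by simp [syms]
  let t := machineTree M d B γ syms states default a₀ b
  have hstep {c c' : TM0.Cfg Γ Λ} {x : Fin 5 → ℚ} (hc : c.q ∈ S) (hx : Represents d B γ c x)
      (h : TM0.step M c = some c') : Represents d B γ c' (t.eval x) := by
    rw [machineTree_eval_of_represents hstates hγ hc hx]
    exact stateTree_eval_of_step_eq_some hd hB h0 hsyms hx h
  refine ⟨t, fun n => ?_⟩
  have hreach {c : TM0.Cfg Γ Λ}
      (h : StateTransition.Reaches (TM0.step M) (TM0.init (a₀ :: List.replicate n b)) c) :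
      c.q ∈ S := by
    induction h with
    | refl => exact hS.1
    | tail _ h ih => exact TM0.step_supports M hS h ih
  have hdom : (f n).Dom ↔ ∃ c, StateTransition.Reaches (TM0.step M)
      (TM0.init (a₀ :: List.replicate n b)) c ∧ TM0.step M c = none := by
    rw [← hM]
    change (StateTransition.eval _ _).Dom ↔ _
    simp only [Part.dom_iff_mem, StateTransition.mem_eval]
  rw [hdom]
  constructor
  · rintro ⟨c, hc, hnone⟩
    have : ∃ m, Represents d B γ c (DecisionTree.orbit (entryUpdate n) t (m + 1)) := by
      clear hnone
      induction hc with
      | refl =>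
        -- After the entry, `n` rounds write the input and one more round starts the machine.
        refine ⟨n + 1, ?_⟩
        rw [DecisionTree.orbit, Function.iterate_succ_apply',
          entryUpdate_apply_zero (d := d) (B := B) (b := b),
          iterate_machineTree_eval_inputVal, zero_add]
        exact represents_machineTree_eval_inputVal_zero n
      | tail h₁ h₂ ih =>
        obtain ⟨m, hm⟩ := ih
        refine ⟨m + 1, ?_⟩
        rw [DecisionTree.orbit, Function.iterate_succ_apply']
        exact hstep (hreach h₁) hm h₂
    obtain ⟨m, hm⟩ := this
    -- One more round executes the halting leaf. Later the value `1` of the state variable may be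
    -- read as a machine state again, which does no harm.
    refine ⟨m + 2, ?_⟩
    rw [DecisionTree.orbit, Function.iterate_succ_apply']
    exact (machineTree_eval_of_represents hstates hγ (hreach hc) hm).trans
      (stateTree_eval_of_step_eq_none _ hnone)
  · intro hn
    -- Either the input is still being written or a reachable configuration is represented; the flag
    -- is `0` in both cases.
    have inv : ∀ m, (∃ j i, j + i = n ∧
          DecisionTree.orbit (entryUpdate n) t (m + 1) = inputVal d B b j i) ∨
        ∃ c, StateTransition.Reaches (TM0.step M) (TM0.init (a₀ :: List.replicate n b)) c ∧
          Represents d B γ c (DecisionTree.orbit (entryUpdate n) t (m + 1)) := by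
      intro m
      induction m with
      | zero => exact Or.inl ⟨0, n, zero_add n, entryUpdate_apply_zero n⟩
      | succ m ih =>
        have hsucc : DecisionTree.orbit (entryUpdate n) t (m + 2) =
            t.eval (DecisionTree.orbit (entryUpdate n) t (m + 1)) := by
          simp only [DecisionTree.orbit, Function.iterate_succ_apply']
        rw [hsucc]
        rcases ih with ⟨j, i, hji, h⟩ | ⟨c, hc, h⟩
        · cases i with
          | zero =>
            right
            refine ⟨_, Relation.ReflTransGen.refl, ?_⟩
            rw [h, ← hji]
            exact represents_machineTree_eval_inputVal_zero j
          | succ i =>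
            refine Or.inl ⟨j + 1, i, by omega, ?_⟩
            rw [h]
            exact machineTree_eval_inputVal_succ j i
        · right
          cases hcs : TM0.step M c with
          | none => exact absurd ⟨c, hc, hcs⟩ hn
          | some c' => exact ⟨c', hc.tail hcs, hstep (hreach hc) h hcs⟩
    intro m
    cases m with
    | zero => rfl
    | succ m =>
      rcases inv m with ⟨j, i, -, h⟩ | ⟨c, -, h⟩
      · rw [h]
        rfl
      · exact h.1

end MomentInv

namespace MomentInv

/-! ### Primitive recursive arithmetic of the integers -/

section IntPrimrec

open Encodable

/-- Integers and `ℕ ⊕ ℕ` share their codes, so primitive recursion on `ℤ` becomes a case distinction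
on the sign. -/
theorem encode_intEquivNatSumNat (z : ℤ) : encode (Equiv.intEquivNatSumNat z) = encode z := by
  cases z <;> rfl

theorem primrec_intEquivNatSumNat : Primrec Equiv.intEquivNatSumNat :=
  Primrec.encode_iff.1 (Primrec.encode.of_eq fun z => (encode_intEquivNatSumNat z).symm)

theorem primrec_intEquivNatSumNat_symm : Primrec Equiv.intEquivNatSumNat.symm := by
  refine Primrec.encode_iff.1 (Primrec.encode.of_eq fun z => ?_)
  rw [← encode_intEquivNatSumNat, Equiv.apply_symm_apply]

variable {α : Type*} [Primcodable α]

theorem primrec_intCast {f : α → ℕ} (hf : Primrec f) : Primrec fun x => (f x : ℤ) :=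
  (primrec_intEquivNatSumNat_symm.comp (Primrec.sumInl.comp hf)).of_eq fun _ => rfl

theorem primrec_toNat {f : α → ℤ} (hf : Primrec f) : Primrec fun x => (f x).toNat := by
  refine (Primrec.sumCasesOn (primrec_intEquivNatSumNat.comp hf) (g := fun _ n => n)
    (h := fun _ _ => 0) Primrec.snd.to₂ (Primrec.const 0).to₂).of_eq fun x => ?_
  cases f x <;> rfl

theorem primrec_subNatNat {f g : α → ℕ} (hf : Primrec f) (hg : Primrec g) :
    Primrec fun x => (f x : ℤ) - g x := by
  have : Primrec fun x => if g x ≤ f x then Sum.inl (f x - g x) else Sum.inr (g x - f x - 1) :=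
    Primrec.ite (Primrec.nat_le.comp hg hf) (Primrec.sumInl.comp (Primrec.nat_sub.comp hf hg))
      (Primrec.sumInr.comp (Primrec.nat_sub.comp (Primrec.nat_sub.comp hg hf) (Primrec.const 1)))
  refine (primrec_intEquivNatSumNat_symm.comp this).of_eq fun x => ?_
  split_ifs with h
  · change ((f x - g x : ℕ) : ℤ) = _
    omega
  · change Int.negSucc (g x - f x - 1) = _
    omega

theorem primrec_neg {f : α → ℤ} (hf : Primrec f) : Primrec fun x => -f x := by
  refine (Primrec.sumCasesOn (primrec_intEquivNatSumNat.comp hf) (g := fun _ (n : ℕ) => -(n : ℤ))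
    (h := fun _ (n : ℕ) => (n : ℤ) + 1) ?_ ?_).of_eq fun x => ?_
  · exact (primrec_subNatNat (Primrec.const 0) Primrec.snd).of_eq fun x => by simp
  · exact (primrec_intCast (Primrec.succ.comp Primrec.snd)).of_eq fun x => by simp
  · cases f x <;> rfl

/-- Splitting into positive and negative parts reduces the operation to a difference of two natural
numbers; the same works for products. -/
theorem primrec_add {f g : α → ℤ} (hf : Primrec f) (hg : Primrec g) :
    Primrec fun x => f x + g x := by
  refine (primrec_subNatNat
    (Primrec.nat_add.comp (primrec_toNat hf) (primrec_toNat hg))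
    (Primrec.nat_add.comp (primrec_toNat (primrec_neg hf)) (primrec_toNat (primrec_neg hg)))).of_eq
    fun x => ?_
  push_cast
  omega

theorem primrec_sub {f g : α → ℤ} (hf : Primrec f) (hg : Primrec g) :
    Primrec fun x => f x - g x :=
  (primrec_add hf (primrec_neg hg)).of_eq fun _ => (sub_eq_add_neg _ _).symm

theorem primrec_mul {f g : α → ℤ} (hf : Primrec f) (hg : Primrec g) :
    Primrec fun x => f x * g x := by
  refine (primrec_subNatNat
    (Primrec.nat_add.comp (Primrec.nat_mul.comp (primrec_toNat hf) (primrec_toNat hg))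
      (Primrec.nat_mul.comp (primrec_toNat (primrec_neg hf)) (primrec_toNat (primrec_neg hg))))
    (Primrec.nat_add.comp (Primrec.nat_mul.comp (primrec_toNat hf) (primrec_toNat (primrec_neg hg)))
      (Primrec.nat_mul.comp (primrec_toNat (primrec_neg hf)) (primrec_toNat hg)))).of_eq
    fun x => ?_
  have h (z : ℤ) : z = z.toNat - (-z).toNat := by omega
  conv_rhs => rw [h (f x), h (g x)]
  push_cast
  ring

theorem primrecPred_lt {f g : α → ℤ} (hf : Primrec f) (hg : Primrec g) :
    PrimrecPred fun x => f x < g x := by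
  refine (Primrec.nat_lt.comp (Primrec.const 0)
    (primrec_toNat (primrec_sub hg hf))).of_eq fun x => ?_
  omega

theorem primrec_list_sum {f : α → List ℤ} (hf : Primrec f) : Primrec fun x => (f x).sum := by
  refine (Primrec.list_foldr (h := fun _ p => p.1 + p.2) hf (Primrec.const 0)
    (primrec_add (Primrec.fst.comp Primrec.snd) (Primrec.snd.comp Primrec.snd)).to₂).of_eq
    fun x => ?_
  induction f x with
  | nil => rfl
  | cons a l ih => simp [ih]

/-- Unbounded search through the codes of elements of `β`. -/
theorem rePred_exists {β : Type*} [Primcodable β] {p : α × β → Prop} (hp : PrimrecPred p) :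
    REPred fun a => ∃ b, p (a, b) := by
  classical
  have h : Primrec₂ fun (a : α) (n : ℕ) =>
      (decode (α := β) n).bind fun b => if p (a, b) then some () else none :=
    Primrec.option_bind (Primrec.decode.comp Primrec.snd)
      (Primrec.ite (hp.comp (Primrec.pair (Primrec.fst.comp Primrec.fst) Primrec.snd))
        (Primrec.const _) (Primrec.const _)).to₂
  refine (Partrec.rfindOpt h.to_comp).dom_re.of_eq fun a => ?_
  rw [Nat.rfindOpt_dom]
  constructor
  · rintro ⟨n, u, h⟩
    simp only [Option.mem_def, Option.bind_eq_some_iff] at h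
    obtain ⟨b, -, h⟩ := h
    exact ⟨b, by_contra fun hb => by simp [hb] at h⟩
  · rintro ⟨b, hb⟩
    exact ⟨encode b, (), by simp [hb]⟩

end IntPrimrec

/-! ### Certificates for nonvanishing sums of algebraic numbers -/

section Certificate

/-- Numerator (a Gaussian integer, by its real and imaginary part) of the value at `(u + v * I) / N`
of the polynomial with the given coefficients, and the powers of `N` and `D` with exponent the
number of coefficients. -/
def homEval (u v N D : ℤ) (l : List ℤ) : ℤ × ℤ × ℤ × ℤ :=
  l.foldr (fun a s => (a * (N * s.2.2.1) + (u * s.1 - v * s.2.1), u * s.2.1 + v * s.1,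
    N * s.2.2.1, D * s.2.2.2)) (0, 0, 1, 1)

/-- The polynomial of `a` is so small at the point `(c.1 + c.2 * I) / N` that it has a root within
distance `1 / D`, and the ball of radius `1 / D` around the point lies in the disc of `a`. -/
def Approx (D N : ℕ) (a : AlgCode) (c : ℤ × ℤ) : Prop :=
  let s := homEval c.1 c.2 N D a.1
  let X := (c.1 * a.2.1.2 - a.2.1.1 * N) * (a.2.2.1.2 * a.2.2.2.2 * D)
  let Y := (c.2 * a.2.2.1.2 - a.2.2.1.1 * N) * (a.2.1.2 * a.2.2.2.2 * D)
  let R := (a.2.2.2.1 * D - a.2.2.2.2) * (N * a.2.1.2 * a.2.2.1.2)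
  (s.1 * s.1 + s.2.1 * s.2.1) * (s.2.2.2 * s.2.2.2) < s.2.2.1 * s.2.2.1 ∧ 0 < R ∧
    X * X + Y * Y < R * R

abbrev ApproxTerm := (AlgCode × List (List ℕ)) × (ℤ × ℤ)

/-- The polynomial with number `C.1` in `B` has a nonvanishing sum of coefficients, as is seen from
approximations of the coefficients up to `1 / C.2.1.1` with the denominator `C.2.1.2`. -/
def Certifies (B : BasisCode) (C : ℕ × (ℕ × ℕ) × List ApproxTerm) : Prop :=
  B[C.1]? = some (C.2.2.map Prod.fst) ∧ 0 < C.2.1.1 ∧ 0 < C.2.1.2 ∧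
    (∀ w ∈ C.2.2, Approx C.2.1.1 C.2.1.2 w.1.1 w.2) ∧
    ((C.2.2.length * C.2.1.2 : ℕ) : ℤ) * ((C.2.2.length * C.2.1.2 : ℕ) : ℤ) <
      ((C.2.2.map fun w => w.2.1).sum * (C.2.2.map fun w => w.2.1).sum +
        (C.2.2.map fun w => w.2.2).sum * (C.2.2.map fun w => w.2.2).sum) *
      ((C.2.1.1 : ℤ) * (C.2.1.1 : ℤ))

theorem primrec_fst {α β γ : Type*} [Primcodable α] [Primcodable β] [Primcodable γ]
    {f : α → β × γ} (hf : Primrec f) : Primrec fun x => (f x).1 := Primrec.fst.comp hf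

theorem primrec_snd {α β γ : Type*} [Primcodable α] [Primcodable β] [Primcodable γ]
    {f : α → β × γ} (hf : Primrec f) : Primrec fun x => (f x).2 := Primrec.snd.comp hf

theorem primrec_homEval {α : Type*} [Primcodable α] {u v N D : α → ℤ} {l : α → List ℤ}
    (hu : Primrec u) (hv : Primrec v) (hN : Primrec N) (hD : Primrec D) (hl : Primrec l) :
    Primrec fun x => homEval (u x) (v x) (N x) (D x) (l x) := by
  have hx {σ : Type} [Primcodable σ] {f : α → σ} (hf : Primrec f) :
      Primrec fun p : α × ℤ × ℤ × ℤ × ℤ × ℤ => f p.1 := hf.comp Primrec.fst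
  have ha : Primrec fun p : α × ℤ × ℤ × ℤ × ℤ × ℤ => p.2.1 := Primrec.fst.comp Primrec.snd
  have hs : Primrec fun p : α × ℤ × ℤ × ℤ × ℤ × ℤ => p.2.2 := Primrec.snd.comp Primrec.snd
  have h1 := primrec_fst hs
  have h2 := primrec_fst (primrec_snd hs)
  have h3 := primrec_fst (primrec_snd (primrec_snd hs))
  have h4 := primrec_snd (primrec_snd (primrec_snd hs))
  refine Primrec.list_foldr (h := fun x p => (p.1 * (N x * p.2.2.2.1) +
    (u x * p.2.1 - v x * p.2.2.1),
    u x * p.2.2.1 + v x * p.2.1, N x * p.2.2.2.1, D x * p.2.2.2.2)) hl (Primrec.const _) ?_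
  exact Primrec.pair
    (primrec_add (primrec_mul ha (primrec_mul (hx hN) h3))
      (primrec_sub (primrec_mul (hx hu) h1) (primrec_mul (hx hv) h2)))
    (Primrec.pair (primrec_add (primrec_mul (hx hu) h2) (primrec_mul (hx hv) h1))
      (Primrec.pair (primrec_mul (hx hN) h3) (primrec_mul (hx hD) h4)))

theorem primrecPred_approx {α : Type*} [Primcodable α] {D N : α → ℕ} {a : α → AlgCode}
    {c : α → ℤ × ℤ} (hD : Primrec D) (hN : Primrec N) (ha : Primrec a) (hc : Primrec c) :
    PrimrecPred fun x => Approx (D x) (N x) (a x) (c x) := by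
  have hD := primrec_intCast hD
  have hN := primrec_intCast hN
  have hu := primrec_fst hc
  have hv := primrec_snd hc
  have hre := primrec_fst (primrec_snd ha)
  have him := primrec_fst (primrec_snd (primrec_snd ha))
  have hrad := primrec_snd (primrec_snd (primrec_snd ha))
  have re1 := primrec_fst hre
  have re2 := primrec_intCast (primrec_snd hre)
  have im1 := primrec_fst him
  have im2 := primrec_intCast (primrec_snd him)
  have rad1 := primrec_fst hrad
  have rad2 := primrec_intCast (primrec_snd hrad)
  have hs := primrec_homEval hu hv hN hD (primrec_fst ha)
  have h1 := primrec_fst hs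
  have h2 := primrec_fst (primrec_snd hs)
  have h3 := primrec_fst (primrec_snd (primrec_snd hs))
  have h4 := primrec_snd (primrec_snd (primrec_snd hs))
  have hX := primrec_mul (primrec_sub (primrec_mul hu re2) (primrec_mul re1 hN))
    (primrec_mul (primrec_mul im2 rad2) hD)
  have hY := primrec_mul (primrec_sub (primrec_mul hv im2) (primrec_mul im1 hN))
    (primrec_mul (primrec_mul re2 rad2) hD)
  have hR := primrec_mul (primrec_sub (primrec_mul rad1 hD) rad2)
    (primrec_mul (primrec_mul hN re2) im2)
  exact (primrecPred_lt (primrec_mul (primrec_add (primrec_mul h1 h1) (primrec_mul h2 h2))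
    (primrec_mul h4 h4)) (primrec_mul h3 h3)).and
    ((primrecPred_lt (Primrec.const 0) hR).and
      (primrecPred_lt (primrec_add (primrec_mul hX hX) (primrec_mul hY hY)) (primrec_mul hR hR)))

/-- With all denominators cleared, checking a certificate needs only integer arithmetic and folds
over lists. -/
theorem primrecPred_certifies :
    PrimrecPred fun p : BasisCode × ℕ × (ℕ × ℕ) × List ApproxTerm => Certifies p.1 p.2 := by
  have hB : Primrec fun p : BasisCode × ℕ × (ℕ × ℕ) × List ApproxTerm => p.1 := Primrec.fst
  have hC : Primrec fun p : BasisCode × ℕ × (ℕ × ℕ) × List ApproxTerm => p.2 := Primrec.snd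
  have hi := primrec_fst hC
  have hDN := primrec_fst (primrec_snd hC)
  have hD := primrec_fst hDN
  have hN := primrec_snd hDN
  have hW := primrec_snd (primrec_snd hC)
  have hR : PrimrecRel fun (w : ApproxTerm) (DN : ℕ × ℕ) => Approx DN.1 DN.2 w.1.1 w.2 :=
    primrecPred_approx (primrec_fst Primrec.snd) (primrec_snd Primrec.snd)
      (primrec_fst (primrec_fst Primrec.fst)) (primrec_snd Primrec.fst)
  have hu := primrec_list_sum (Primrec.list_map hW (g := fun _ w => w.2.1)
    (primrec_fst (primrec_snd Primrec.snd)).to₂)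
  have hv := primrec_list_sum (Primrec.list_map hW (g := fun _ w => w.2.2)
    (primrec_snd (primrec_snd Primrec.snd)).to₂)
  have hlen := primrec_intCast (Primrec.nat_mul.comp (Primrec.list_length.comp hW) hN)
  have hD' := primrec_intCast hD
  refine (Primrec.eq.comp (Primrec.list_getElem?.comp hB hi) (Primrec.option_some.comp
    (Primrec.list_map hW (g := fun _ w => w.1) (primrec_fst Primrec.snd).to₂))).and
    ((Primrec.nat_lt.comp (Primrec.const 0) hD).and ((Primrec.nat_lt.comp (Primrec.const 0) hN).and
    ((hR.forall_mem_list.comp hW hDN).and (primrecPred_lt (primrec_mul hlen hlen)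
      (primrec_mul (primrec_add (primrec_mul hu hu) (primrec_mul hv hv))
        (primrec_mul hD' hD'))))))

theorem rePred_exists_certifies : REPred fun B : BasisCode => ∃ C, Certifies B C :=
  rePred_exists primrecPred_certifies

end Certificate

end MomentInv

namespace MomentInv

open Filter Topology Polynomial

/-! ### Approximation of algebraic numbers by Gaussian rationals -/

section Approximation

/-- The leading coefficient is a nonzero integer, so `‖p(c)‖` is at least the product of the
distances from `c` to the roots. If all of them were at least `1 / D`, then `‖p(c)‖ * D ^ m` would
be at least `1`. -/
theorem exists_root_near {p : ℤ[X]} (hp : p ≠ 0) {m : ℕ} (hm : p.natDegree ≤ m) {c : ℂ} {D : ℕ}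
    (hD : 0 < D) (h : ‖aeval c p‖ * (D : ℝ) ^ m < 1) :
    ∃ w : ℂ, aeval w p = 0 ∧ ‖w - c‖ < 1 / D := by
  by_contra! hfar
  have hD' : (1 : ℝ) ≤ D := by exact_mod_cast hD
  have hinj : Function.Injective (algebraMap ℤ ℂ) := by
    simpa using (Int.cast_injective (α := ℂ))
  have hp' : p.map (algebraMap ℤ ℂ) ≠ 0 := (Polynomial.map_ne_zero_iff hinj).2 hp
  have hs : (p.map (algebraMap ℤ ℂ)).Splits := IsAlgClosed.splits _
  have key : ∀ s : Multiset ℂ, (∀ w ∈ s, 1 / (D : ℝ) ≤ ‖w - c‖) →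
      1 ≤ ‖(s.map fun w => c - w).prod‖ * (D : ℝ) ^ s.card := by
    intro s
    induction s using Multiset.induction_on with
    | empty => simp
    | cons w s ih =>
      intro hw
      have h1 := ih fun w hw' => hw w (Multiset.mem_cons_of_mem hw')
      have h2 := hw w (Multiset.mem_cons_self w s)
      rw [div_le_iff₀ (by linarith), norm_sub_rev] at h2
      rw [Multiset.map_cons, Multiset.prod_cons, norm_mul, Multiset.card_cons, pow_succ]
      calc (1 : ℝ) ≤ (‖c - w‖ * D) * (‖(s.map fun w => c - w).prod‖ * (D : ℝ) ^ s.card) :=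
            one_le_mul_of_one_le_of_one_le h2 h1
        _ = _ := by ring
  have h1 := key (p.map (algebraMap ℤ ℂ)).roots fun w hw => hfar w (by
    have := (mem_roots hp').1 hw
    rwa [IsRoot, eval_map_algebraMap] at this)
  have hcard : (p.map (algebraMap ℤ ℂ)).roots.card = p.natDegree := by
    rw [← hs.natDegree_eq_card_roots, natDegree_map_eq_of_injective hinj]
  have heval : aeval c p = (p.leadingCoeff : ℂ) *
      ((p.map (algebraMap ℤ ℂ)).roots.map fun w => c - w).prod := by
    rw [← eval_map_algebraMap, hs.eval_eq_prod_roots, leadingCoeff_map_of_injective hinj]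
    simp
  have hlead : 1 ≤ ‖(p.leadingCoeff : ℂ)‖ := by
    rw [Complex.norm_intCast]
    exact_mod_cast Int.one_le_abs (leadingCoeff_ne_zero.2 hp)
  rw [hcard] at h1
  have h2 : ‖((p.map (algebraMap ℤ ℂ)).roots.map fun w => c - w).prod‖ ≤ ‖aeval c p‖ := by
    rw [heval, norm_mul]
    exact le_mul_of_one_le_left (norm_nonneg _) hlead
  have h3 : (D : ℝ) ^ p.natDegree ≤ (D : ℝ) ^ m := pow_le_pow_right₀ hD' hm
  have := mul_le_mul h2 h3 (by positivity) (norm_nonneg _)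
  linarith

theorem tendsto_floor_mul_div (x : ℝ) :
    Tendsto (fun N : ℕ => (⌊N * x⌋ : ℝ) / N) atTop (𝓝 x) := by
  have h : Tendsto (fun N : ℕ => x - 1 / (N : ℝ)) atTop (𝓝 x) := by
    simpa using tendsto_const_nhds.sub (tendsto_const_div_atTop_nhds_zero_nat (1 : ℝ))
  refine tendsto_of_tendsto_of_tendsto_of_le_of_le' h tendsto_const_nhds ?_ ?_
  · filter_upwards [eventually_gt_atTop 0] with N hN
    have hN' : (0 : ℝ) < N := by exact_mod_cast hN
    rw [le_div_iff₀ hN', sub_mul, one_div_mul_cancel hN'.ne']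
    linarith [Int.sub_one_lt_floor (N * x)]
  · filter_upwards [eventually_gt_atTop 0] with N hN
    have hN' : (0 : ℝ) < N := by exact_mod_cast hN
    rw [div_le_iff₀ hN']
    linarith [Int.floor_le (N * x)]

noncomputable def gaussianPoint (N : ℕ) (c : ℤ × ℤ) : ℂ := ⟨(c.1 : ℝ) / N, (c.2 : ℝ) / N⟩

theorem tendsto_gaussianPoint_floor (z : ℂ) :
    Tendsto (fun N : ℕ => gaussianPoint N (⌊N * z.re⌋, ⌊N * z.im⌋)) atTop (𝓝 z) := by
  have h := (Complex.equivRealProdCLM.symm.continuous.tendsto (z.re, z.im)).comp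
    ((tendsto_floor_mul_div z.re).prodMk_nhds (tendsto_floor_mul_div z.im))
  exact h

theorem AlgName.poly_natDegree_le (a : AlgName) : a.poly.natDegree ≤ a.coeffs.length := by
  refine natDegree_sum_le_of_forall_le _ _ fun i hi => (natDegree_monomial_le _).trans ?_
  exact (Finset.mem_range.1 hi).le

/-- Horner's scheme with cleared denominators: each coefficient contributes one factor `N`. -/
theorem homEval_eq (l : List ℤ) (c : ℤ × ℤ) {N : ℕ} (hN : 0 < N) (D : ℕ) :
    ((homEval c.1 c.2 N D l).1 : ℂ) + (homEval c.1 c.2 N D l).2.1 * Complex.I =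
      N ^ l.length * aeval (gaussianPoint N c)
        (∑ i ∈ Finset.range l.length, monomial i (l.getD i 0) : ℤ[X]) ∧
    (homEval c.1 c.2 N D l).2.2 = ((N : ℤ) ^ l.length, (D : ℤ) ^ l.length) := by
  have hN' : (N : ℂ) ≠ 0 := by exact_mod_cast hN.ne'
  have hc : (N : ℂ) * gaussianPoint N c = c.1 + c.2 * Complex.I := by
    have hN'' : (N : ℝ) ≠ 0 := by exact_mod_cast hN.ne'
    apply Complex.ext <;> simp [gaussianPoint] <;> field_simp
  induction l with
  | nil => simp [homEval]
  | cons a l ih =>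
    obtain ⟨ih1, ih2⟩ := ih
    have hstep : homEval c.1 c.2 N D (a :: l) =
        (fun s : ℤ × ℤ × ℤ × ℤ => (a * (N * s.2.2.1) + (c.1 * s.1 - c.2 * s.2.1),
          c.1 * s.2.1 + c.2 * s.1, N * s.2.2.1, D * s.2.2.2)) (homEval c.1 c.2 N D l) := rfl
    rw [hstep]
    refine ⟨?_, ?_⟩
    · have hpoly : aeval (gaussianPoint N c)
          (∑ i ∈ Finset.range (a :: l).length, monomial i ((a :: l).getD i 0) : ℤ[X]) =
          a + gaussianPoint N c * aeval (gaussianPoint N c)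
            (∑ i ∈ Finset.range l.length, monomial i (l.getD i 0) : ℤ[X]) := by
        simp only [map_add, map_sum, aeval_monomial, List.length_cons, Finset.sum_range_succ',
          List.getD_cons_succ, List.getD_cons_zero, Finset.mul_sum]
        rw [add_comm (a : ℂ)]
        congr 1
        · exact Finset.sum_congr rfl fun i _ => by simp; ring
        · simp
      rw [hpoly]
      have h3 : (homEval c.1 c.2 N D l).2.2.1 = (N : ℤ) ^ l.length := by rw [ih2]
      simp only [h3, List.length_cons]
      push_cast
      have : (N : ℂ) ^ (l.length + 1) * (a + gaussianPoint N c * aeval (gaussianPoint N c)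
            (∑ i ∈ Finset.range l.length, monomial i (l.getD i 0) : ℤ[X])) =
          a * (N * N ^ l.length) + (N * gaussianPoint N c) * (N ^ l.length *
            aeval (gaussianPoint N c)
              (∑ i ∈ Finset.range l.length, monomial i (l.getD i 0) : ℤ[X])) := by ring
      rw [this, hc, ← ih1]
      linear_combination (-(c.2 : ℂ) * (homEval c.1 c.2 N D l).2.1) * Complex.I_sq
    · simp only [ih2, List.length_cons, pow_succ']

/-- The integer inequalities are these bounds, squared and multiplied by common denominators. The
condition `0 < R` permits taking square roots again. -/
theorem approx_iff (a : AlgName) (c : ℤ × ℤ) {D N : ℕ} (hD : 0 < D) (hN : 0 < N) :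
    Approx D N a.code c ↔
      ‖aeval (gaussianPoint N c) a.poly‖ * (D : ℝ) ^ a.coeffs.length < 1 ∧
      ‖gaussianPoint N c - ⟨(a.re : ℝ), (a.im : ℝ)⟩‖ < a.radius - 1 / D := by
  have hD' : (0 : ℝ) < D := by exact_mod_cast hD
  have hN' : (0 : ℝ) < N := by exact_mod_cast hN
  obtain ⟨h1, h2⟩ := homEval_eq a.coeffs c hN D
  unfold Approx
  simp only [AlgName.code, ratCode]
  set s := homEval c.1 c.2 N D a.coeffs with hs
  refine and_congr ?_ ?_
  · have hn : (s.1 : ℝ) * s.1 + s.2.1 * s.2.1 =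
        ((N : ℝ) ^ a.coeffs.length) ^ 2 * ‖aeval (gaussianPoint N c) a.poly‖ ^ 2 := by
      have h := congrArg (fun z : ℂ => ‖z‖ ^ 2) h1
      simp only [norm_mul, norm_pow, Complex.norm_natCast, mul_pow] at h
      rw [AlgName.poly, ← h, Complex.sq_norm, Complex.normSq_apply]
      simp
    rw [h2, ← Int.cast_lt (R := ℝ)]
    push_cast
    rw [hn]
    have hp : 0 < ((N : ℝ) ^ a.coeffs.length) ^ 2 := by positivity
    have e1 : ((N : ℝ) ^ a.coeffs.length) ^ 2 * ‖aeval (gaussianPoint N c) a.poly‖ ^ 2 *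
        ((D : ℝ) ^ a.coeffs.length * (D : ℝ) ^ a.coeffs.length) =
        ((N : ℝ) ^ a.coeffs.length) ^ 2 *
          (‖aeval (gaussianPoint N c) a.poly‖ * (D : ℝ) ^ a.coeffs.length) ^ 2 := by ring
    have e2 : (N : ℝ) ^ a.coeffs.length * (N : ℝ) ^ a.coeffs.length =
        ((N : ℝ) ^ a.coeffs.length) ^ 2 * 1 := by ring
    rw [e1, e2, mul_lt_mul_iff_right₀ hp, sq_lt_one_iff₀ (by positivity)]
  · have hre : (0 : ℝ) < a.re.den := by exact_mod_cast a.re.den_pos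
    have him : (0 : ℝ) < a.im.den := by exact_mod_cast a.im.den_pos
    have hra : (0 : ℝ) < a.radius.den := by exact_mod_cast a.radius.den_pos
    have ere : (a.re : ℝ) = a.re.num / a.re.den := Rat.cast_def _
    have eim : (a.im : ℝ) = a.im.num / a.im.den := Rat.cast_def _
    have era : (a.radius : ℝ) = a.radius.num / a.radius.den := Rat.cast_def _
    have hM : (0 : ℝ) < N * a.re.den * a.im.den * a.radius.den * D := by positivity
    set M : ℝ := N * a.re.den * a.im.den * a.radius.den * D with hMdef
    have hsq : ‖gaussianPoint N c - ⟨(a.re : ℝ), (a.im : ℝ)⟩‖ ^ 2 =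
        ((c.1 : ℝ) / N - a.re) ^ 2 + ((c.2 : ℝ) / N - a.im) ^ 2 := by
      rw [Complex.sq_norm, Complex.normSq_apply]
      simp [gaussianPoint]
      ring
    rw [← Int.cast_lt (R := ℝ), ← Int.cast_lt (R := ℝ)]
    push_cast
    have eX : ((c.1 : ℝ) * a.re.den - a.re.num * N) * (a.im.den * a.radius.den * D) =
        M * ((c.1 : ℝ) / N - a.re) := by
      rw [ere, hMdef]
      field_simp
    have eY : ((c.2 : ℝ) * a.im.den - a.im.num * N) * (a.re.den * a.radius.den * D) =
        M * ((c.2 : ℝ) / N - a.im) := by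
      rw [eim, hMdef]
      field_simp
    have eR : ((a.radius.num : ℝ) * D - a.radius.den) * (N * a.re.den * a.im.den) =
        M * (a.radius - 1 / D) := by
      rw [era, hMdef]
      field_simp
    rw [eX, eY, eR]
    have e3 : M * ((c.1 : ℝ) / N - a.re) * (M * ((c.1 : ℝ) / N - a.re)) +
        M * ((c.2 : ℝ) / N - a.im) * (M * ((c.2 : ℝ) / N - a.im)) =
        M ^ 2 * ‖gaussianPoint N c - ⟨(a.re : ℝ), (a.im : ℝ)⟩‖ ^ 2 := by
      rw [hsq]
      ring
    have e4 : M * ((a.radius : ℝ) - 1 / D) * (M * (a.radius - 1 / D)) =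
        M ^ 2 * (a.radius - 1 / D) ^ 2 := by ring
    rw [e3, e4, mul_lt_mul_iff_right₀ (by positivity), mul_pos_iff_of_pos_left hM]
    constructor
    · rintro ⟨h0, h⟩
      exact lt_of_pow_lt_pow_left₀ 2 h0.le h
    · intro h
      have h0 := (norm_nonneg _).trans_lt h
      exact ⟨h0, pow_lt_pow_left₀ h (norm_nonneg _) two_ne_zero⟩

/-- The root found within `1 / D` of the point lies in the isolating disc, so it is `z`. -/
theorem AlgName.Denotes.norm_sub_lt {a : AlgName} {z : QBar} (h : a.Denotes z) {c : ℤ × ℤ}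
    {D N : ℕ} (hD : 0 < D) (hN : 0 < N) (hc : Approx D N a.code c) :
    ‖(z : ℂ) - gaussianPoint N c‖ < 1 / D := by
  obtain ⟨h1, h2⟩ := (approx_iff a c hD hN).1 hc
  obtain ⟨w, hw, hwc⟩ := exists_root_near h.poly_ne_zero a.poly_natDegree_le hD h1
  have : w = z := by
    refine h.unique w ?_ hw
    rw [AlgName.disc, Metric.mem_ball, dist_eq_norm]
    calc ‖w - _‖ ≤ ‖w - gaussianPoint N c‖ + ‖gaussianPoint N c - _‖ :=
          norm_sub_le_norm_sub_add_norm_sub _ _ _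
      _ < _ := by linarith
  rwa [← this]

/-- First `D` is taken so large that `z` stays more than `1 / D` inside the disc; then, for this
`D`, continuity at the root `z` makes the polynomial small enough once `N` is large. -/
theorem AlgName.Denotes.eventually_approx {a : AlgName} {z : QBar} (h : a.Denotes z) :
    ∀ᶠ D : ℕ in atTop, ∀ᶠ N : ℕ in atTop,
      Approx D N a.code (⌊N * (z : ℂ).re⌋, ⌊N * (z : ℂ).im⌋) := by
  have hz := h.mem_disc
  rw [AlgName.disc, Metric.mem_ball, dist_eq_norm] at hz
  have hr : Tendsto (fun D : ℕ => (a.radius : ℝ) - 1 / D) atTop (𝓝 a.radius) := by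
    simpa using tendsto_const_nhds.sub (tendsto_const_div_atTop_nhds_zero_nat (1 : ℝ))
  filter_upwards [hr.eventually_const_lt hz, eventually_gt_atTop 0] with D hD hD0
  have hN := tendsto_gaussianPoint_floor (z : ℂ)
  have h1 : Tendsto (fun N : ℕ => ‖aeval (gaussianPoint N (⌊N * (z : ℂ).re⌋, ⌊N * (z : ℂ).im⌋))
      a.poly‖ * (D : ℝ) ^ a.coeffs.length) atTop (𝓝 0) := by
    have := ((((a.poly).continuous_aeval (A := ℂ)).tendsto (z : ℂ)).comp hN).norm.mul_const
      ((D : ℝ) ^ a.coeffs.length)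
    rw [h.isRoot] at this
    simpa using this
  have h2 := (hN.sub_const (⟨(a.re : ℝ), (a.im : ℝ)⟩ : ℂ)).norm
  filter_upwards [h1.eventually_lt_const one_pos, h2.eventually_lt_const hD,
    eventually_gt_atTop 0] with N e1 e2 hN0
  exact (approx_iff a _ hD0 hN0).2 ⟨e1, e2⟩

end Approximation

end MomentInv

namespace MomentInv

open Filter Topology

/-! ### Certificates detect exactly the nonzero sums of coefficients -/

section Nonvanishing

variable {k ℓ : ℕ}

/-- At the all-ones point every monomial is `1`, so only the coefficients count, and like terms need
not be collected. -/
theorem PolyDenotes.exists_coeffs {s : PolyName k ℓ} {p : MvPolynomial (Moment k ℓ) QBar}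
    (h : PolyDenotes s p) : ∃ zs : List QBar, List.Forall₂ (fun t z => t.1.Denotes z) s zs ∧
      MvPolynomial.eval (fun _ => (1 : QBar)) p = zs.sum := by
  obtain ⟨ps, hps, rfl⟩ := h
  induction hps with
  | nil => exact ⟨[], .nil, by simp⟩
  | @cons t p s ps ht _ ih =>
    obtain ⟨zs, hzs, hsum⟩ := ih
    obtain ⟨z, hz, rfl⟩ := ht
    refine ⟨z :: zs, .cons hz hzs, ?_⟩
    have h1 (l : List (Moment k ℓ)) : MvPolynomial.eval (fun _ => (1 : QBar))
        (l.map (MvPolynomial.X (R := QBar))).prod = 1 := by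
      induction l with
      | nil => simp
      | cons α l ih => simp [ih]
    simp [h1, hsum]

/-- The sum of the approximations in a certificate. -/
noncomputable def approxSum (N : ℕ) (W : List ApproxTerm) : ℂ :=
  gaussianPoint N ((W.map fun w => w.2.1).sum, (W.map fun w => w.2.2).sum)

theorem approxSum_nil (N : ℕ) : approxSum N [] = 0 := by
  apply Complex.ext <;> simp [approxSum, gaussianPoint]

theorem approxSum_cons (N : ℕ) (w : ApproxTerm) (W : List ApproxTerm) :
    approxSum N (w :: W) = gaussianPoint N w.2 + approxSum N W := by
  apply Complex.ext <;> simp [approxSum, gaussianPoint, add_div]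

theorem norm_sum_sub_approxSum_le {D N : ℕ} (hD : 0 < D) (hN : 0 < N) {s : PolyName k ℓ}
    {zs : List QBar} (h : List.Forall₂ (fun t z => t.1.Denotes z) s zs) {W : List ApproxTerm}
    (hW : W.map Prod.fst = polyCode s) (ha : ∀ w ∈ W, Approx D N w.1.1 w.2) :
    ‖((zs.sum : QBar) : ℂ) - approxSum N W‖ ≤ W.length / D := by
  induction h generalizing W with
  | nil =>
    obtain rfl : W = [] := by simpa [polyCode] using hW
    simp [approxSum_nil]
  | @cons t z s zs ht _ ih =>
    obtain ⟨w, W, rfl, hw, hW⟩ := List.map_eq_cons_iff.1 hW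
    have h1 := ih hW fun w' hw' => ha w' (by simp [hw'])
    have h2 := ha w (by simp)
    rw [hw] at h2
    have h3 := ht.norm_sub_lt hD hN h2
    rw [List.sum_cons, approxSum_cons, List.length_cons, Nat.cast_succ, AddMemClass.coe_add,
      add_sub_add_comm, add_div, add_comm (_ / _)]
    exact (norm_add_le _ _).trans (add_le_add h3.le h1)

theorem exists_approximations {s : PolyName k ℓ} {zs : List QBar}
    (h : List.Forall₂ (fun t z => t.1.Denotes z) s zs) :
    ∃ W : ℕ → List ApproxTerm, (∀ N, (W N).map Prod.fst = polyCode s) ∧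
      (∀ᶠ D : ℕ in atTop, ∀ᶠ N : ℕ in atTop, ∀ w ∈ W N, Approx D N w.1.1 w.2) ∧
      Tendsto (fun N => approxSum N (W N)) atTop (𝓝 ((zs.sum : QBar) : ℂ)) := by
  induction h with
  | nil => exact ⟨fun _ => [], fun _ => rfl, by simp, by simp [approxSum_nil]⟩
  | @cons t z s zs ht _ ih =>
    obtain ⟨W, hW, happ, hlim⟩ := ih
    refine ⟨fun N => ((t.1.code, t.2.map fun α => List.ofFn α.1),
      (⌊N * (z : ℂ).re⌋, ⌊N * (z : ℂ).im⌋)) :: W N, fun N => by simp [hW, polyCode], ?_, ?_⟩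
    · filter_upwards [happ, ht.eventually_approx] with D h1 h2
      filter_upwards [h1, h2] with N h1 h2
      exact List.forall_mem_cons.2 ⟨h2, h1⟩
    · simp only [approxSum_cons, List.sum_cons, AddMemClass.coe_add]
      exact (tendsto_gaussianPoint_floor (z : ℂ)).add hlim

theorem sum_condition_iff {D N : ℕ} (hD : 0 < D) (hN : 0 < N) (W : List ApproxTerm) :
    ((W.length * N : ℕ) : ℤ) * ((W.length * N : ℕ) : ℤ) <
      ((W.map fun w => w.2.1).sum * (W.map fun w => w.2.1).sum +
        (W.map fun w => w.2.2).sum * (W.map fun w => w.2.2).sum) * ((D : ℤ) * (D : ℤ)) ↔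
    (W.length : ℝ) / D < ‖approxSum N W‖ := by
  have hD' : (0 : ℝ) < D := by exact_mod_cast hD
  have hN' : (0 : ℝ) < N := by exact_mod_cast hN
  have hsq : ‖approxSum N W‖ ^ 2 = ((((W.map fun w => w.2.1).sum : ℤ) : ℝ) / N) ^ 2 +
      ((((W.map fun w => w.2.2).sum : ℤ) : ℝ) / N) ^ 2 := by
    rw [Complex.sq_norm, Complex.normSq_apply, approxSum, gaussianPoint]
    ring
  have hlt : (W.length : ℝ) / D < ‖approxSum N W‖ ↔
      ((W.length : ℝ) / D) ^ 2 < ‖approxSum N W‖ ^ 2 :=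
    (pow_lt_pow_iff_left₀ (by positivity) (norm_nonneg _) two_ne_zero).symm
  rw [hlt, hsq, ← Int.cast_lt (R := ℝ)]
  set u := (W.map fun w => w.2.1).sum
  set v := (W.map fun w => w.2.2).sum
  have hp : (0 : ℝ) < ((N : ℝ) * D) ^ 2 := by positivity
  conv_rhs => rw [← mul_lt_mul_iff_right₀ hp]
  push_cast
  have e1 : ((N : ℝ) * D) ^ 2 * ((W.length : ℝ) / D) ^ 2 =
      (W.length : ℝ) * N * (W.length * N) := by
    field_simp
  have e2 : ((N : ℝ) * D) ^ 2 * (((u : ℝ) / N) ^ 2 + ((v : ℝ) / N) ^ 2) =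
      ((u : ℝ) * u + v * v) * (D * D) := by
    field_simp
  rw [e1, e2]

/-- Approximations to within `1 / D` give a total error of at most `W.length / D`, so a larger
approximate sum excludes `0`. Conversely, the error bound tends to `0` while the approximate sums
tend to the true one. -/
theorem sum_ne_zero_iff_exists_approximations {s : PolyName k ℓ} {zs : List QBar}
    (h : List.Forall₂ (fun t z => t.1.Denotes z) s zs) :
    zs.sum ≠ 0 ↔ ∃ (D N : ℕ) (W : List ApproxTerm), W.map Prod.fst = polyCode s ∧ 0 < D ∧ 0 < N ∧
      (∀ w ∈ W, Approx D N w.1.1 w.2) ∧ (W.length : ℝ) / D < ‖approxSum N W‖ := by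
  constructor
  · intro hz
    obtain ⟨W, hW, happ, hlim⟩ := exists_approximations h
    have hlen (N : ℕ) : (W N).length = s.length := by
      simpa [polyCode] using congrArg List.length (hW N)
    have hpos : 0 < ‖((zs.sum : QBar) : ℂ)‖ := by
      rw [norm_pos_iff]
      exact_mod_cast hz
    have h1 := (tendsto_const_div_atTop_nhds_zero_nat (s.length : ℝ)).eventually_lt_const hpos
    obtain ⟨D, hD, hD1, hD0⟩ := (happ.and (h1.and (eventually_gt_atTop 0))).exists
    obtain ⟨N, hN, hN1, hN0⟩ :=
      (hD.and ((hlim.norm.eventually_const_lt hD1).and (eventually_gt_atTop 0))).exists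
    exact ⟨D, N, W N, hW N, hD0, hN0, hN, by rwa [hlen]⟩
  · rintro ⟨D, N, W, hW, hD, hN, ha, hlt⟩ hz
    have := norm_sum_sub_approxSum_le hD hN h hW ha
    rw [hz] at this
    simp only [ZeroMemClass.coe_zero, zero_sub, norm_neg] at this
    linarith

theorem exists_certifies_iff {B : List (PolyName k ℓ)}
    {ps : List (MvPolynomial (Moment k ℓ) QBar)} (h : List.Forall₂ PolyDenotes B ps) :
    (∃ C, Certifies (basisCode B) C) ↔
      ∃ p ∈ ps, MvPolynomial.eval (fun _ => (1 : QBar)) p ≠ 0 := by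
  have key : (∃ C, Certifies (basisCode B) C) ↔ ∃ s ∈ B, ∃ (D N : ℕ) (W : List ApproxTerm),
      W.map Prod.fst = polyCode s ∧ 0 < D ∧ 0 < N ∧
      (∀ w ∈ W, Approx D N w.1.1 w.2) ∧ (W.length : ℝ) / D < ‖approxSum N W‖ := by
    constructor
    · rintro ⟨⟨i, ⟨D, N⟩, W⟩, hi, hD, hN, ha, hs⟩
      simp only [basisCode, List.getElem?_map, Option.map_eq_some_iff] at hi
      obtain ⟨s, hs', hW⟩ := hi
      exact ⟨s, List.mem_of_getElem? hs', D, N, W, hW.symm, hD, hN, ha,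
        (sum_condition_iff hD hN W).1 hs⟩
    · rintro ⟨s, hs, D, N, W, hW, hD, hN, ha, hlt⟩
      obtain ⟨i, hi⟩ := List.mem_iff_getElem?.1 hs
      exact ⟨⟨i, ⟨D, N⟩, W⟩, by simp [basisCode, hi, hW], hD, hN, ha,
        (sum_condition_iff hD hN W).2 hlt⟩
  rw [key]
  clear key
  induction h with
  | nil => simp
  | @cons s p B ps hs _ ih =>
    obtain ⟨zs, hzs, heval⟩ := hs.exists_coeffs
    simp only [List.exists_mem_cons_iff, ih, heval, sum_ne_zero_iff_exists_approximations hzs]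

end Nonvanishing

/-! ### Reduction from the halting problem -/

section Reduction

/-- Only the constant term of the entry update depends on `n`; the rest of the code is fixed data.
-/
theorem primrec_loop_code (t : DecisionTree 5) :
    Primrec fun n : ℕ => (t.loop (entryUpdate n)).code := by
  have hn : Primrec fun n : ℕ => ((n : ℤ), 1) :=
    Primrec.pair (primrec_intCast Primrec.id) (Primrec.const 1)
  have hb : Primrec fun n : ℕ => ([(0, 1), (0, 1), (0, 1), (0, 1), ((n : ℤ), 1)] : List RatCode) :=
    Primrec.list_cons.comp (Primrec.const _) <| Primrec.list_cons.comp (Primrec.const _) <|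
      Primrec.list_cons.comp (Primrec.const _) <| Primrec.list_cons.comp (Primrec.const _) <|
      Primrec.list_cons.comp hn (Primrec.const [])
  have he : Primrec fun n : ℕ => ((false, [[]],
      ((entryUpdate 0).code.1, [(0, 1), (0, 1), (0, 1), (0, 1), ((n : ℤ), 1)]), (1, 1), true) :
      TransitionCode) :=
    Primrec.pair (Primrec.const _) <| Primrec.pair (Primrec.const _) <|
      Primrec.pair (Primrec.pair (Primrec.const _) hb) (Primrec.const _)
  refine (Primrec.pair (Primrec.const 5) (Primrec.pair (Primrec.const false)
    (Primrec.list_cons.comp he (Primrec.const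
      ((t.loop (entryUpdate 0)).E.tail.map Transition.code))))).of_eq fun n => ?_
  simp [Program.code, DecisionTree.loop, Transition.code, Guard.code, AffineUpdate.code,
    entryUpdate, Loc.code, ratCode, List.ofFn_succ]

end Reduction

end MomentInv

theorem theorem3 (ℓ : ℕ) (hℓ : 1 ≤ ℓ) :
    ¬ ∃ F : MomentInv.ProgramCode →. MomentInv.BasisCode, Partrec F ∧
      ∀ (k : ℕ) (L : MomentInv.Program MomentInv.Loc k), L.Valid → L.IsLoop →
        ∃ B : List (MomentInv.PolyName k ℓ),
          MomentInv.basisCode B ∈ F L.code ∧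
          MomentInv.IsBasis B (MomentInv.momentIdeal L ℓ) := by
  open MomentInv in
  rintro ⟨F, hF, hspec⟩
  -- A universal function, so that a single loop body `t` serves all programs.
  have hf : Partrec fun n : ℕ => (Denumerable.ofNat Nat.Partrec.Code n).eval 0 :=
    Nat.Partrec.Code.eval_part.comp (Computable.ofNat _) (Computable.const 0)
  obtain ⟨t, ht⟩ := exists_tree_orbit hf
  refine ComputablePred.halting_problem_not_re 0 ?_
  let code (c : Nat.Partrec.Code) : ProgramCode := (t.loop (entryUpdate (Encodable.encode c))).code
  have hcode : Computable code := ((primrec_loop_code t).comp Primrec.encode).to_comp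
  -- Compute a basis, then search for a certificate: this terminates exactly if `c` diverges on `0`.
  have hpart : Partrec fun c => (F (code c)).bind fun B =>
      Part.assert (∃ C, Certifies B C) fun _ => Part.some () :=
    (hF.comp hcode).bind (rePred_exists_certifies.comp Computable.snd).to₂
  refine hpart.dom_re.of_eq fun c => ?_
  obtain ⟨B, hB, ps, hps, hspan⟩ := hspec 5 (t.loop (entryUpdate (Encodable.encode c)))
    (DecisionTree.loop_valid _ _) (DecisionTree.loop_isLoop _ _)
  obtain ⟨hdom, hndom⟩ := ht (Encodable.encode c)
  simp only [Denumerable.ofNat_encode] at hdom hndom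
  have hiff := DecisionTree.exists_eval_one_ne_zero_iff _ t hℓ 0
    ((em (c.eval 0).Dom).imp hdom hndom) hspan
  have horbit : (∃ m, DecisionTree.orbit (entryUpdate (Encodable.encode c)) t m = 1) ↔
      (c.eval 0).Dom := by
    refine ⟨fun ⟨m, hm⟩ => by_contra fun h => ?_, hdom⟩
    have := hndom h m
    simp [hm] at this
  rw [← horbit, ← hiff, Part.eq_some_iff.2 hB, Part.bind_some]
  simp only [Set.mem_ofPred_eq]
  rw [← exists_certifies_iff hps]
  exact ⟨fun h => h.1, fun h => ⟨h, trivial⟩⟩
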